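/- **Parameters.** Fix sets of values, program variables, lock names, binary operator names and registers (all arbitrary). Shared variables are the program variables and the lock variables (one for each lock name); a *memory* $mem$ maps shared variables to values. A *mode state* $mds$ assigns to each mode $\mathsf{AsmNoW},\mathsf{AsmNoRW},\mathsf{GuarNoW},\mathsf{GuarNoRW}$ a set of shared variables. Fix an interpretation of the operators; a predicate "true" on values; a predicate "held" on values with two distinguished values, one that is held (written on acquisition) and one that is not (written on release); for each lock $k$ two sets $W_k,RW_k$ of program variables; for each shared variable $x$ a set $\mathrm{cvars}(x)$ of control variables; and two register-allocation functions. A *register record* $\Phi$ is a partial map from registers to expressions. $\mathrm{alloc}(\Phi,A)$ fails or returns a register not in $A$; $\mathrm{cached}(\Phi,A,v)$ fails or returns a register $r\notin A$ with $\Phi(r)=v$. A local configuration is $\langle\cdot,mds,mem\rangle$ with a thread-private first component. **While.** Expressions are $e::=n\mid v\mid e\oplus e$. Commands are $c::=\mathsf{stop}\mid\mathsf{skip}\mid c;c\mid\mathsf{if}\,e\,\mathsf{then}\,c\,\mathsf{else}\,c\mid\mathsf{while}\,e\,\mathsf{do}\,c\mid v:=e\mid\mathsf{Lock}\,k\mid\mathsf{Unlock}\,k$.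 The relation $\leadsto_w$ is the small-step semantics: $\mathsf{skip}$ and $v:=e$ step to $\mathsf{stop}$, with the obvious effect; $\mathsf{stop}$ does not step; $\mathsf{if}$ evaluates $e$ and steps to the chosen branch; $\mathsf{while}\,e\,\mathsf{do}\,c$ steps to $\mathsf{if}\,e\,\mathsf{then}\,(c;\mathsf{while}\,e\,\mathsf{do}\,c)\,\mathsf{else}\,\mathsf{stop}$; $c_1;c_2$ steps as $c_1$ does, to $c_1';c_2$ if $c_1'\neq\mathsf{stop}$ and to $c_2$ if $c_1'=\mathsf{stop}$. $\mathsf{Lock}\,k$, if $k$ is not held, steps to $\mathsf{stop}$, writes the held value to $k$, adds $W_k$ to $mds(\mathsf{AsmNoW})$ and $RW_k$ to $mds(\mathsf{AsmNoRW})$, and removes them from $mds(\mathsf{GuarNoW})$ and $mds(\mathsf{GuarNoRW})$ respectively; if $k$ is held it steps to itself. $\mathsf{Unlock}\,k$ does the reverse, writing the released value, if $W_k\subseteq mds(\mathsf{AsmNoW})$ and $RW_k\subseteq mds(\mathsf{AsmNoRW})$; otherwise it steps to itself. **RISC.** The thread-private state is $(pc,P,regs)$ with a program counter $pc\in\mathbb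 N$ (positions start at $0$), a list $P$ of instructions, each optionally labelled by a natural number, and a register bank. The instructions are $\mathsf{Load}\,r\,v$, $\mathsf{Store}\,v\,r$, $\mathsf{Jmp}\,l$, $\mathsf{Jz}\,l\,r$, $\mathsf{Nop}$, $\mathsf{Nop}'$ (which behaves like $\mathsf{Nop}$), $\mathsf{MoveK}\,r\,n$, $\mathsf{MoveR}\,r\,r'$, $\mathsf{Op}\,\oplus\,r\,r'$ (result in $r$), $\mathsf{LockAcq}\,k$, $\mathsf{LockRel}\,k$. The relation $\leadsto_r$ executes the instruction at $pc$; there is no step when $pc\ge|P|$. A jump to $l$ goes to the first instruction labelled $l$, or to $|P|$ if there is none; $\mathsf{Jz}$ jumps if $regs(r)$ is not true. The lock instructions act on $mds,mem$ as the While commands do, and stay at the same $pc$ when those step to themselves; all other instructions advance $pc$ by one. **Records and stability.** A *compilation record* is $C=(\Phi,S)$ with a register record $\Phi$ and a pair $S=(S_1,S_2)$ of sets of shared variables. The shared variable $x$ is *stable* in $S$ if $\{x\}\cup\mathrm{cvars}(x)\subseteq S_1\cup S_2$; an expression is stable if all its variables are. $C$ is *regrec-stable* if all expressions in the range of $\Phi$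 are stable in $S$. $C$ is *consistent* with $(regs,mds,mem)$ if $regs(r)$ equals the value of $e$ in $mem$ whenever $\Phi(r)=e$, and $S=(mds(\mathsf{AsmNoW}),mds(\mathsf{AsmNoRW}))$. Let $S+k=(S_1\cup W_k,S_2\cup RW_k)$ and $S-k=(S_1\setminus W_k,S_2\setminus RW_k)$. Let $\mathrm{aft}(c,S)$ be $S+k$ for $\mathsf{Lock}\,k$, $S-k$ for $\mathsf{Unlock}\,k$, $\mathrm{aft}(c_2,\mathrm{aft}(c_1,S))$ for $c_1;c_2$, $\mathrm{aft}(c_1,S)$ for $\mathsf{if}\,e\,\mathsf{then}\,c_1\,\mathsf{else}\,c_2$, and $S$ otherwise. A command $c$ has *no unstable expressions* from $S$ if, following $\mathrm{aft}$ through $c$ from $S$, each expression in an assignment or condition is stable where it occurs, the two branches of each conditional have equal $\mathrm{aft}$, and each loop body started at $S'$ has $\mathrm{aft}=S'$. **Compiler.** Each emitted instruction is annotated with a record $C_{pc}$, the current record just before it. In what follows an entry label is put on the first instruction emitted, and a failure of any part makes the whole fail. $\mathsf{cexpr}(C,A,l,e)$, with $C=(\Phi,S)$, returns annotated code, a result register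 $r$ and a final record. For $n$: $r=\mathrm{alloc}(\Phi,A)$, code $\mathsf{MoveK}\,r\,n$, record $C$ updated by $r\mapsto n$. For $v$: if $\mathrm{cached}(\Phi,A,v)=r$, no code and record $C$; otherwise $r=\mathrm{alloc}(\Phi,A)$, code $\mathsf{Load}\,r\,v$, update $r\mapsto v$. For $e_1\oplus e_2$: compile $e_1$, giving $r_1,C_1$; compile $e_2$ from $C_1$ with $A\cup\{r_1\}$, giving $r_2$; emit $\mathsf{Op}\,\oplus\,r_1\,r_2$; update $r_1\mapsto e_1\oplus e_2$; the result is $r_1$. $\mathsf{compile}(C,l,nl,c)$, with optional entry label $l$ and next available label $nl$, returns annotated code, an optional exit label, a new next label and a final record. The exit label is none and the next label is unchanged unless stated otherwise. - $\mathsf{stop}$: fails. - $\mathsf{skip}$: $\mathsf{Nop}$, record $C$. - $v:=e$: $\mathsf{cexpr}(C,\emptyset,l,e)=(P_e,r,C_1)$; fail if $v\in W_k\cup RW_k$ for some $k$ and $v$ is not stable in $C_1$; code $P_e$, $\mathsf{Store}\,v\,r$; from $C_1$ remove the entries whose expression mentions $v$. - $c_1;c_2$: compile $c_1$, then compile $c_2$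 with the resulting record, exit label and next label; concatenate. - $\mathsf{if}\,e\,\mathsf{then}\,c_1\,\mathsf{else}\,c_2$: $\mathsf{cexpr}(C,\emptyset,l,e)=(P_e,r,C_1)$, $br=nl$, $ex=nl+1$, $\mathsf{compile}(C_1,\text{none},nl+2,c_1)=(P_1,l_1,nl_1,C_2)$, $\mathsf{compile}(C_1,br,nl_1,c_2)=(P_2,l_2,nl_2,C_3)$; code $P_e,\ \mathsf{Jz}\,br\,r,\ P_1,\ l_1{:}\,\mathsf{Jmp}\,ex,\ P_2,\ l_2{:}\,\mathsf{Nop}'$; exit label $ex$, next label $nl_2$; the record has the register mappings common to $C_2$ and $C_3$ and the assumption part of $C_2$. - $\mathsf{while}\,e\,\mathsf{do}\,c$: $lp=l$, or $nl$ if $l$ is none; $ex=nl+1$; $\mathsf{cexpr}((\emptyset,S),\emptyset,lp,e)=(P_e,r,C_1)$, $\mathsf{compile}(C_1,\text{none},nl+2,c)=(P_c,l_c,nl_c,C_2)$; code $P_e,\ \mathsf{Jz}\,ex\,r,\ P_c,\ l_c{:}\,\mathsf{Jmp}\,lp$; exit label $ex$, next label $nl_c$, record $C_1$. - $\mathsf{Lock}\,k$: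 $\mathsf{LockAcq}\,k$; record $(\Phi,S+k)$. - $\mathsf{Unlock}\,k$: $\mathsf{LockRel}\,k$; record $S-k$, keeping the register entries stable in $S-k$. *Input requirements* on $(C,l,nl,c)$: $c\ne\mathsf{stop}$, $l<nl$ if $l$ is a label, $c$ has no unstable expressions from $S$, and $C$ is regrec-stable. **Pacing.** The leftmost command of $c_1;c_2$ is that of $c_1$; that of any other command is the command itself. $\mathsf{abs\text{-}steps}_{wr}(lc_w,lc_r)$ is determined by the instruction of $lc_r$ at $pc$: for $\mathsf{Load}$, $\mathsf{Op}$, $\mathsf{MoveK}$ it is $1$ if the leftmost command of $lc_w$ is a $\mathsf{while}$ loop and $0$ otherwise; for $\mathsf{Jmp}$ and $\mathsf{Nop}'$ it is $0$; for every other instruction it is $1$. (When there is no instruction at $pc$, set it to $0$.) **Joinable.** $P_1,P_2$ are joinable if every label to which $P_1$ jumps labels an instruction of $P_1$ or is the label of the first instruction of $P_2$, and $P_2$ jumps to no label of an instruction of $P_1$. **The relation.** $\mathcal R_{wr}$ is the least relation closed under the rules below. All pairs have equal $mds$ and $mem$ on both sides, so write $c\sim(pc,P)$ for $\langle c,mds,mem\rangle\mathrel{\mathcal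 R_{wr}}\langle(pc,P,regs),mds,mem\rangle$, and let $P$ also denote the underlying code of annotated code. *Guarded at $pc$* means that $pc<|P|$ and that $C_{pc}$ is regrec-stable and consistent with $(regs,mds,mem)$. *$c$ starts $P$ from $C$* means that $\langle c,mds',mem'\rangle\mathrel{\mathcal R_{wr}}\langle(0,P,regs'),mds',mem'\rangle$ for all $regs',mds',mem'$ with which $C$ is consistent, provided that $C$ is regrec-stable. Wherever code is said to be compiled from a command $c$, this is a successful $\mathsf{compile}(C,l,nl,c)$ with the input requirements for $(C,l,nl,c)$ met, and the parts $P_e,P_1,P_2,P_c,C_1,\dots$ are those in the description of the compiler. 1. (stop) $\mathsf{stop}\sim(|P|,P)$ for every $P$. 2. (skip) $\mathsf{skip}\sim(0,P)$, $P$ compiled from $\mathsf{skip}$, guarded at $0$. 3. (assign\_expr) $v:=e\sim(pc,P)$, $P$ compiled from $v:=e$, $pc<|P_e|$, guarded at $pc$. 4. (assign\_store) $v:=e\sim(|P_e|,P)$, $P$ compiled from $v:=e$, guarded at $|P_e|$, and $v$ is stable in $C_1$ or lies in no $W_k\cup RW_k$. 5. (lock\_acq) $\mathsf{Lock}\,k\sim(0,P)$,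 $P$ compiled from $\mathsf{Lock}\,k$, guarded at $0$. 6. (lock\_rel) $\mathsf{Unlock}\,k\sim(0,P)$, $P$ compiled from $\mathsf{Unlock}\,k$, guarded at $0$. 7. (seq) Let $P_1$ be the code of $c_1$ with final record $C_1$, and $P_2$ the code of $c_2$, in the compilation of $c_1;c_2$. If $P_1,P_2$ are joinable, $pc<|P_1|$, guarded at $pc$, $c_1'\sim(pc,P_1)$, and $c_2$ starts $P_2$ from $C_1$, then $c_1';c_2\sim(pc,P_1P_2)$ if $c_1'\ne\mathsf{stop}$, and $c_2\sim(pc,P_1P_2)$ if $c_1'=\mathsf{stop}$. 8. (join) If $P_1,P_2$ are joinable, $pc\ge|P_1|$ and $c\sim(pc-|P_1|,P_2)$, then $c\sim(pc,P_1P_2)$. 9. (if\_expr) $\mathsf{if}\,e\,\mathsf{then}\,c_1\,\mathsf{else}\,c_2\sim(pc,P)$, $P$ compiled from it, $pc\le|P_e|$, guarded at $pc$, $c_1$ starts $P_1$ from $C_1$ and $c_2$ starts $P_2$ from $C_1$. 10. (if\_c1) With $P$ as in 9: if $pc<|P_1|$, guarded at $|P_e|+1+pc$, and $c_1'\sim(pc,P_1)$,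 then $c_1'\sim(|P_e|+1+pc,P)$. 11. (if\_c2) With $P$ as in 9: if $pc<|P_2|$, guarded at $|P_e|+1+|P_1|+1+pc$, and $c_2'\sim(pc,P_2)$, then $c_2'\sim(|P_e|+1+|P_1|+1+pc,P)$. 12. (epilogue\_step) If the instruction of $P$ at $pc$ is a $\mathsf{Jmp}$ or $\mathsf{Nop}'$, and $lc_w'\mathrel{\mathcal R_{wr}}lc_r'$ whenever $lc_r=\langle(pc,P,regs),mds,mem\rangle\leadsto_r lc_r'$ and $lc_w'$ is reached from $lc_w=\langle\mathsf{stop},mds,mem\rangle$ in exactly $\mathsf{abs\text{-}steps}_{wr}(lc_w,lc_r)$ steps, then $lc_w\mathrel{\mathcal R_{wr}}lc_r$. 13. (while\_expr) Let $w=\mathsf{while}\,e\,\mathsf{do}\,c$ and $P$ be compiled from $w$. If $pc\le|P_e|$, guarded at $pc$, and $c$ starts $P_c$ from $C_1$, then $w\sim(0,P)$ if $pc=0$, and $\mathsf{if}\,e\,\mathsf{then}\,(c;w)\,\mathsf{else}\,\mathsf{stop}\sim(pc,P)$ if $pc>0$. 14. (while\_inner) With $w,P$ as in 13: if $pc<|P_c|$,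 guarded at $|P_e|+1+pc$, $c'\ne\mathsf{stop}$, $c'\sim(pc,P_c)$, and $c$ starts $P_c$ from $C_1$, then $c';w\sim(|P_e|+1+pc,P)$. 15. (while\_loop) With $w,P$ as in 13: if $pc\le|P_c|$, guarded at $|P_e|+1+pc$, $\mathsf{stop}\sim(pc,P_c)$, and $c$ starts $P_c$ from $C_1$, then $w\sim(|P_e|+1+pc,P)$. **Lemma.** For all local configurations $lc_w$ of While and $lc_r$ of RISC with $(lc_w,lc_r)\in\mathcal R_{wr}$, and every $lc_r'$ with $lc_r\leadsto_r lc_r'$, there is $lc_w'$ such that $lc_w\leadsto_w^{\,n}lc_w'$ in exactly $n=\mathsf{abs\text{-}steps}_{wr}(lc_w,lc_r)$ steps, and $(lc_w',lc_r')\in\mathcal R_{wr}$. -/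

import Mathlib

namespace WRCompiler

universe u₁ u₂ u₃ u₄ u₅

/-! ### Shared memory, modes, local configurations -/

/-- Shared variables: program variables and lock variables, all residing in shared memory. -/
inductive SVar (Var : Type u₂) (Lock : Type u₃) where
  | prog (v : Var)
  | lock (k : Lock)

inductive Mode where
  | AsmNoW
  | AsmNoRW
  | GuarNoW
  | GuarNoRW

/-- Access mode states. -/
abbrev MdsState (Var : Type u₂) (Lock : Type u₃) := Mode → Set (SVar Var Lock)

/-- Shared memories: total maps from shared variables to values. -/
abbrev Mem (Val : Type u₁) (Var : Type u₂) (Lock : Type u₃) := SVar Var Lock → Val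

/-- Local configurations `⟨tps, mds, mem⟩` with thread-private state of type `T`. -/
structure LocalConf (T : Type*) (Val : Type u₁) (Var : Type u₂) (Lock : Type u₃) where
  tps : T
  mds : MdsState Var Lock
  mem : Mem Val Var Lock

/-! ### Syntax -/

/-- Expressions over constants, program variables and (names of) binary operators. -/
inductive Expr (Val : Type u₁) (Var : Type u₂) (Op : Type u₄) where
  | const (n : Val)
  | var (v : Var)
  | bin (o : Op) (e₁ e₂ : Expr Val Var Op)

/-- Commands of the language `While`; `halt` is the terminated program. -/
inductive Cmd (Val : Type u₁) (Var : Type u₂) (Lock : Type u₃) (Op : Type u₄) where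
  | halt
  | skip
  | seq (c₁ c₂ : Cmd Val Var Lock Op)
  | ite (e : Expr Val Var Op) (c₁ c₂ : Cmd Val Var Lock Op)
  | while (e : Expr Val Var Op) (c : Cmd Val Var Lock Op)
  | assign (v : Var) (e : Expr Val Var Op)
  | lockAcq (k : Lock)
  | lockRel (k : Lock)

/-- Instructions of the language `RISC`. The compiler emits `nop` for `skip`; `nopEpi` is a
no-op with the same behaviour, which the compiler emits at the end of the second branch of a
conditional and which the pacing function thereby recognises as an epilogue step. -/
inductive Instr (Val : Type u₁) (Var : Type u₂) (Lock : Type u₃) (Op : Type u₄)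
    (Reg : Type u₅) where
  | load (r : Reg) (v : Var)
  | store (v : Var) (r : Reg)
  | jmp (l : ℕ)
  | jz (l : ℕ) (r : Reg)
  | nop
  | nopEpi
  | moveK (r : Reg) (n : Val)
  | moveR (r r' : Reg)
  | op (o : Op) (r r' : Reg)
  | lockAcq (k : Lock)
  | lockRel (k : Lock)

/-- Optionally labelled instructions; labels are natural numbers. -/
abbrev LInstr (Val : Type u₁) (Var : Type u₂) (Lock : Type u₃) (Op : Type u₄)
    (Reg : Type u₅) := Option ℕ × Instr Val Var Lock Op Reg

/-- Thread-private state of a `RISC` thread: program counter, program text, register bank. -/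
structure RState (Val : Type u₁) (Var : Type u₂) (Lock : Type u₃) (Op : Type u₄)
    (Reg : Type u₅) where
  pc : ℕ
  text : List (LInstr Val Var Lock Op Reg)
  regs : Reg → Val

abbrev WConf (Val : Type u₁) (Var : Type u₂) (Lock : Type u₃) (Op : Type u₄) :=
  LocalConf (Cmd Val Var Lock Op) Val Var Lock

abbrev RConf (Val : Type u₁) (Var : Type u₂) (Lock : Type u₃) (Op : Type u₄)
    (Reg : Type u₅) :=
  LocalConf (RState Val Var Lock Op Reg) Val Var Lock

/-- Register records: partial maps from registers to expressions. -/
abbrev RegRec (Val : Type u₁) (Var : Type u₂) (Op : Type u₄) (Reg : Type u₅) :=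
  Reg → Option (Expr Val Var Op)

/-- Assumption records: the variables with an active `AsmNoW`, resp. `AsmNoRW` assumption. -/
abbrev AsmRec (Var : Type u₂) (Lock : Type u₃) := Set (SVar Var Lock) × Set (SVar Var Lock)

/-- Compilation records. -/
structure CompRec (Val : Type u₁) (Var : Type u₂) (Lock : Type u₃) (Op : Type u₄)
    (Reg : Type u₅) where
  regrec : RegRec Val Var Op Reg
  asmrec : AsmRec Var Lock

/-- The parameters that the user of the theory supplies. -/
structure Params (Val : Type u₁) (Var : Type u₂) (Lock : Type u₃) (Op : Type u₄)
    (Reg : Type u₅) where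
  /-- interpretation of the binary operators -/
  evOp : Op → Val → Val → Val
  /-- which values count as true in branching (the others count as zero) -/
  isTrue : Val → Prop
  /-- which values of a lock variable mean that the lock is held -/
  isHeld : Val → Prop
  /-- value written to a lock variable on acquisition -/
  heldVal : Val
  /-- value written to a lock variable on release -/
  freeVal : Val
  isHeld_heldVal : isHeld heldVal
  not_isHeld_freeVal : ¬ isHeld freeVal
  /-- the program variables over which a lock grants exclusive permission to write, resp. to
  read and write -/
  lockInterp : Lock → Set Var × Set Var
  /-- control variables of a shared variable -/
  cvars : SVar Var Lock → Set (SVar Var Lock)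
  /-- allocation of a fresh register outside a set of registers in use; it may fail -/
  regAlloc : RegRec Val Var Op Reg → Set Reg → Option Reg
  /-- search for a register recorded to hold a given variable already -/
  regAllocCached : RegRec Val Var Op Reg → Set Reg → Var → Option Reg
  regAlloc_notMem : ∀ Φ A r, regAlloc Φ A = some r → r ∉ A
  regAllocCached_notMem : ∀ Φ A v r, regAllocCached Φ A v = some r → r ∉ A
  regAllocCached_eq : ∀ Φ A v r, regAllocCached Φ A v = some r → Φ r = some (.var v)

section

variable {Val : Type u₁} {Var : Type u₂} {Lock : Type u₃} {Op : Type u₄} {Reg : Type u₅}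

open Classical in
/-- Update of a total map at one point. -/
noncomputable def upd {α β : Type*} (f : α → β) (a : α) (b : β) : α → β :=
  fun x => if x = a then b else f x

/-! ### Semantics -/

/-- `ev_exp mem e`. -/
def Expr.ev (Θ : Params Val Var Lock Op Reg) (mem : Mem Val Var Lock) : Expr Val Var Op → Val
  | .const n => n
  | .var v => mem (.prog v)
  | .bin o e₁ e₂ => Θ.evOp o (e₁.ev Θ mem) (e₂.ev Θ mem)

/-- `exp-vars e`. -/
def Expr.vars : Expr Val Var Op → Set Var
  | .const _ => ∅
  | .var v => {v}
  | .bin _ e₁ e₂ => e₁.vars ∪ e₂.vars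

namespace Params

variable (Θ : Params Val Var Lock Op Reg)

/-- Shared variables over which `k` grants exclusive permission to write. -/
def lockNoW (k : Lock) : Set (SVar Var Lock) := SVar.prog '' (Θ.lockInterp k).1

/-- Shared variables over which `k` grants exclusive permission to read and write. -/
def lockNoRW (k : Lock) : Set (SVar Var Lock) := SVar.prog '' (Θ.lockInterp k).2

/-- Acquiring `k` trades guarantees for assumptions. -/
def acqMds (k : Lock) (mds : MdsState Var Lock) : MdsState Var Lock
  | .AsmNoW => mds .AsmNoW ∪ Θ.lockNoW k
  | .AsmNoRW => mds .AsmNoRW ∪ Θ.lockNoRW k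
  | .GuarNoW => mds .GuarNoW \ Θ.lockNoW k
  | .GuarNoRW => mds .GuarNoRW \ Θ.lockNoRW k

/-- Releasing `k` trades assumptions for guarantees. -/
def relMds (k : Lock) (mds : MdsState Var Lock) : MdsState Var Lock
  | .AsmNoW => mds .AsmNoW \ Θ.lockNoW k
  | .AsmNoRW => mds .AsmNoRW \ Θ.lockNoRW k
  | .GuarNoW => mds .GuarNoW ∪ Θ.lockNoW k
  | .GuarNoRW => mds .GuarNoRW ∪ Θ.lockNoRW k

/-- The mode state contains all permissions that holding `k` grants. -/
def holdsPerms (k : Lock) (mds : MdsState Var Lock) : Prop :=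
  Θ.lockNoW k ⊆ mds .AsmNoW ∧ Θ.lockNoRW k ⊆ mds .AsmNoRW

/-- Evaluation steps of `While`. When the first component of a sequence terminates, the
sequence continues as its second component. Acquiring an unavailable lock, and
releasing a lock without its permissions, spins. -/
inductive WStep : WConf Val Var Lock Op → WConf Val Var Lock Op → Prop
  | skip (mds mem) : WStep ⟨.skip, mds, mem⟩ ⟨.halt, mds, mem⟩
  | assign (v e mds mem) :
      WStep ⟨.assign v e, mds, mem⟩ ⟨.halt, mds, upd mem (.prog v) (e.ev Θ mem)⟩
  | seq (c₁ c₁' c₂ mds mds' mem mem') :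
      WStep ⟨c₁, mds, mem⟩ ⟨c₁', mds', mem'⟩ → c₁' ≠ .halt →
      WStep ⟨.seq c₁ c₂, mds, mem⟩ ⟨.seq c₁' c₂, mds', mem'⟩
  | seq_halt (c₁ c₂ mds mds' mem mem') :
      WStep ⟨c₁, mds, mem⟩ ⟨.halt, mds', mem'⟩ →
      WStep ⟨.seq c₁ c₂, mds, mem⟩ ⟨c₂, mds', mem'⟩
  | ite_true (e c₁ c₂ mds mem) :
      Θ.isTrue (e.ev Θ mem) → WStep ⟨.ite e c₁ c₂, mds, mem⟩ ⟨c₁, mds, mem⟩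
  | ite_false (e c₁ c₂ mds mem) :
      ¬ Θ.isTrue (e.ev Θ mem) → WStep ⟨.ite e c₁ c₂, mds, mem⟩ ⟨c₂, mds, mem⟩
  | while (e c mds mem) :
      WStep ⟨.while e c, mds, mem⟩ ⟨.ite e (.seq c (.while e c)) .halt, mds, mem⟩
  | lockAcq (k mds mem) :
      ¬ Θ.isHeld (mem (.lock k)) →
      WStep ⟨.lockAcq k, mds, mem⟩ ⟨.halt, Θ.acqMds k mds, upd mem (.lock k) Θ.heldVal⟩
  | lockAcq_spin (k mds mem) :
      Θ.isHeld (mem (.lock k)) → WStep ⟨.lockAcq k, mds, mem⟩ ⟨.lockAcq k, mds, mem⟩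
  | lockRel (k mds mem) :
      Θ.holdsPerms k mds →
      WStep ⟨.lockRel k, mds, mem⟩ ⟨.halt, Θ.relMds k mds, upd mem (.lock k) Θ.freeVal⟩
  | lockRel_spin (k mds mem) :
      ¬ Θ.holdsPerms k mds → WStep ⟨.lockRel k, mds, mem⟩ ⟨.lockRel k, mds, mem⟩

end Params

/-- The target of a jump to `l`: the position of the first instruction labelled `l`, or the
end of the program text if there is none. -/
def resolve (P : List (LInstr Val Var Lock Op Reg)) (l : ℕ) : ℕ :=
  P.findIdx (fun i => i.1 == some l)

namespace Params

variable (Θ : Params Val Var Lock Op Reg)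

/-- `Exec P i pc regs mds mem pc' regs' mds' mem'`: effect of executing the instruction `i`
at position `pc` of the program text `P`. -/
inductive Exec (P : List (LInstr Val Var Lock Op Reg)) :
    Instr Val Var Lock Op Reg →
    ℕ → (Reg → Val) → MdsState Var Lock → Mem Val Var Lock →
    ℕ → (Reg → Val) → MdsState Var Lock → Mem Val Var Lock → Prop
  | load (r v pc regs mds mem) :
      Exec P (.load r v) pc regs mds mem (pc + 1) (upd regs r (mem (.prog v))) mds mem
  | store (v r pc regs mds mem) :
      Exec P (.store v r) pc regs mds mem (pc + 1) regs mds (upd mem (.prog v) (regs r))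
  | jmp (l pc regs mds mem) :
      Exec P (.jmp l) pc regs mds mem (resolve P l) regs mds mem
  | jz_jump (l r pc regs mds mem) :
      ¬ Θ.isTrue (regs r) → Exec P (.jz l r) pc regs mds mem (resolve P l) regs mds mem
  | jz_next (l r pc regs mds mem) :
      Θ.isTrue (regs r) → Exec P (.jz l r) pc regs mds mem (pc + 1) regs mds mem
  | nop (pc regs mds mem) : Exec P .nop pc regs mds mem (pc + 1) regs mds mem
  | nopEpi (pc regs mds mem) : Exec P .nopEpi pc regs mds mem (pc + 1) regs mds mem
  | moveK (r n pc regs mds mem) :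
      Exec P (.moveK r n) pc regs mds mem (pc + 1) (upd regs r n) mds mem
  | moveR (r r' pc regs mds mem) :
      Exec P (.moveR r r') pc regs mds mem (pc + 1) (upd regs r (regs r')) mds mem
  | op (o r r' pc regs mds mem) :
      Exec P (.op o r r') pc regs mds mem
        (pc + 1) (upd regs r (Θ.evOp o (regs r) (regs r'))) mds mem
  | lockAcq (k pc regs mds mem) :
      ¬ Θ.isHeld (mem (.lock k)) →
      Exec P (.lockAcq k) pc regs mds mem
        (pc + 1) regs (Θ.acqMds k mds) (upd mem (.lock k) Θ.heldVal)
  | lockAcq_spin (k pc regs mds mem) :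
      Θ.isHeld (mem (.lock k)) → Exec P (.lockAcq k) pc regs mds mem pc regs mds mem
  | lockRel (k pc regs mds mem) :
      Θ.holdsPerms k mds →
      Exec P (.lockRel k) pc regs mds mem
        (pc + 1) regs (Θ.relMds k mds) (upd mem (.lock k) Θ.freeVal)
  | lockRel_spin (k pc regs mds mem) :
      ¬ Θ.holdsPerms k mds → Exec P (.lockRel k) pc regs mds mem pc regs mds mem

/-- Evaluation steps of `RISC`: execute the instruction at the program counter; there is no
step when the program counter is outside the program text. -/
inductive RStep : RConf Val Var Lock Op Reg → RConf Val Var Lock Op Reg → Prop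
  | mk (P : List (LInstr Val Var Lock Op Reg)) (lo i pc regs mds mem pc' regs' mds' mem') :
      P[pc]? = some (lo, i) →
      Θ.Exec P i pc regs mds mem pc' regs' mds' mem' →
      RStep ⟨⟨pc, P, regs⟩, mds, mem⟩ ⟨⟨pc', P, regs'⟩, mds', mem'⟩

/-! ### Stability -/

/-- `var-stable S v`. -/
def varStable (S : AsmRec Var Lock) (x : SVar Var Lock) : Prop :=
  x ∈ S.1 ∪ S.2 ∧ ∀ y ∈ Θ.cvars x, y ∈ S.1 ∪ S.2

/-- All variables of `e` are stable. -/
def exprStable (S : AsmRec Var Lock) (e : Expr Val Var Op) : Prop :=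
  ∀ v ∈ e.vars, Θ.varStable S (.prog v)

/-- `regrec-stable C`. -/
def regrecStable (C : CompRec Val Var Lock Op Reg) : Prop :=
  ∀ r e, C.regrec r = some e → Θ.exprStable C.asmrec e

/-- Access to `v` is governed by some lock. -/
def lockGoverned (v : Var) : Prop :=
  ∃ k, v ∈ (Θ.lockInterp k).1 ∪ (Θ.lockInterp k).2

/-- Writing to `v` respects the locking discipline: `v` is stable, or no lock governs it. -/
def writeSafe (S : AsmRec Var Lock) (v : Var) : Prop :=
  Θ.lockGoverned v → Θ.varStable S (.prog v)

/-- Effect of acquiring `k` on the assumption record. -/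
def acqAsm (k : Lock) (S : AsmRec Var Lock) : AsmRec Var Lock :=
  (S.1 ∪ Θ.lockNoW k, S.2 ∪ Θ.lockNoRW k)

/-- Effect of releasing `k` on the assumption record. -/
def relAsm (k : Lock) (S : AsmRec Var Lock) : AsmRec Var Lock :=
  (S.1 \ Θ.lockNoW k, S.2 \ Θ.lockNoRW k)

/-- The assumption record after `c`, for a command `c` whose branches agree on it and whose
loop bodies restore it. -/
def asmAfter : Cmd Val Var Lock Op → AsmRec Var Lock → AsmRec Var Lock
  | .seq c₁ c₂, S => asmAfter c₂ (asmAfter c₁ S)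
  | .ite _ c₁ _, S => asmAfter c₁ S
  | .lockAcq k, S => Θ.acqAsm k S
  | .lockRel k, S => Θ.relAsm k S
  | _, S => S

/-- The static check behind `noUnstableExprs`: every evaluated expression mentions only
variables that are stable at that point, the two branches of a conditional act consistently
on the assumption record, and loop bodies restore it. -/
def stableFrom : Cmd Val Var Lock Op → AsmRec Var Lock → Prop
  | .seq c₁ c₂, S => stableFrom c₁ S ∧ stableFrom c₂ (Θ.asmAfter c₁ S)
  | .ite e c₁ c₂, S =>
      Θ.exprStable S e ∧ stableFrom c₁ S ∧ stableFrom c₂ S ∧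
        Θ.asmAfter c₁ S = Θ.asmAfter c₂ S
  | .while e c, S => Θ.exprStable S e ∧ stableFrom c S ∧ Θ.asmAfter c S = S
  | .assign _ e, S => Θ.exprStable S e
  | _, _ => True

/-- `no-unstable-exprs c C`. -/
def noUnstableExprs (c : Cmd Val Var Lock Op) (C : CompRec Val Var Lock Op Reg) : Prop :=
  Θ.stableFrom c C.asmrec

/-! ### The compiler -/

open Classical in
/-- Compilation of the expression `e`, with compilation record `C`, registers `A` in use and
entry label `l`. It returns the code, each instruction annotated with the compilation record
just before it, the register that finally holds the value, and the final compilation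
record, or `none` if register allocation fails. -/
noncomputable def compileExpr (C : CompRec Val Var Lock Op Reg) (A : Set Reg) (l : Option ℕ) :
    Expr Val Var Op →
    Option (List (LInstr Val Var Lock Op Reg × CompRec Val Var Lock Op Reg) × Reg ×
      CompRec Val Var Lock Op Reg)
  | .const n =>
      match Θ.regAlloc C.regrec A with
      | none => none
      | some r => some ([((l, .moveK r n), C)], r, ⟨upd C.regrec r (some (.const n)), C.asmrec⟩)
  | .var v =>
      match Θ.regAllocCached C.regrec A v with
      | some r => some ([], r, C)
      | none =>
        match Θ.regAlloc C.regrec A with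
        | none => none
        | some r => some ([((l, .load r v), C)], r, ⟨upd C.regrec r (some (.var v)), C.asmrec⟩)
  | .bin o e₁ e₂ =>
      match compileExpr C A l e₁ with
      | none => none
      | some (P₁, r₁, C₁) =>
        match compileExpr C₁ (A ∪ {r₁}) (if P₁ = [] then l else none) e₂ with
        | none => none
        | some (P₂, r₂, C₂) =>
          some (P₁ ++ P₂ ++ [((if P₁ ++ P₂ = [] then l else none, .op o r₁ r₂), C₂)], r₁,
            ⟨upd C₂.regrec r₁ (some (.bin o e₁ e₂)), C₂.asmrec⟩)

open Classical in
/-- Keep only the register record entries whose expression satisfies `p`. -/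
noncomputable def keep (p : Expr Val Var Op → Prop) (Φ : RegRec Val Var Op Reg) :
    RegRec Val Var Op Reg :=
  fun r => (Φ r).filter (fun e => decide (p e))

open Classical in
/-- The mappings on which two register records agree. -/
noncomputable def meet (Φ Φ' : RegRec Val Var Op Reg) : RegRec Val Var Op Reg :=
  fun r => if Φ r = Φ' r then Φ r else none

open Classical in
/-- Compilation of a command, with initial compilation record `C`, entry label `l` and next
available label `nl`. It returns the annotated code, the exit label, the new next available
label and the final compilation record, or `none` if compilation fails. -/
noncomputable def compileCmd (C : CompRec Val Var Lock Op Reg) (l : Option ℕ) (nl : ℕ) :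
    Cmd Val Var Lock Op →
    Option (List (LInstr Val Var Lock Op Reg × CompRec Val Var Lock Op Reg) × Option ℕ ×
      ℕ × CompRec Val Var Lock Op Reg)
  | .halt => none
  | .skip => some ([((l, .nop), C)], none, nl, C)
  | .assign v e =>
      match Θ.compileExpr C ∅ l e with
      | none => none
      | some (Pe, r, C₁) =>
        if Θ.writeSafe C₁.asmrec v then
          some (Pe ++ [((if Pe = [] then l else none, .store v r), C₁)], none, nl,
            ⟨keep (fun e' => v ∉ e'.vars) C₁.regrec, C₁.asmrec⟩)
        else none
  | .seq c₁ c₂ =>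
      match compileCmd C l nl c₁ with
      | none => none
      | some (P₁, l₁, nl₁, C₁) =>
        match compileCmd C₁ l₁ nl₁ c₂ with
        | none => none
        | some (P₂, l₂, nl₂, C₂) => some (P₁ ++ P₂, l₂, nl₂, C₂)
  | .ite e c₁ c₂ =>
      match Θ.compileExpr C ∅ l e with
      | none => none
      | some (Pe, r, C₁) =>
        let br := nl
        let ex := nl + 1
        match compileCmd C₁ none (nl + 2) c₁ with
        | none => none
        | some (P₁, l₁, nl₁, C₂) =>
          match compileCmd C₁ (some br) nl₁ c₂ with
          | none => none
          | some (P₂, l₂, nl₂, C₃) =>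
            some (Pe ++ [((if Pe = [] then l else none, .jz br r), C₁)] ++
                P₁ ++ [((l₁, .jmp ex), C₂)] ++ P₂ ++ [((l₂, .nopEpi), C₃)],
              some ex, nl₂, ⟨meet C₂.regrec C₃.regrec, C₂.asmrec⟩)
  | .while e c =>
      let lp := l.getD nl
      let ex := nl + 1
      -- the register record is flushed, which forces evaluation of the loop condition
      match Θ.compileExpr ⟨fun _ => none, C.asmrec⟩ ∅ (some lp) e with
      | none => none
      | some (Pe, r, C₁) =>
        match compileCmd C₁ none (nl + 2) c with
        | none => none
        | some (Pc, lc, nlc, C₂) =>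
          some (Pe ++ [((none, .jz ex r), C₁)] ++ Pc ++ [((lc, .jmp lp), C₂)],
            some ex, nlc, C₁)
  | .lockAcq k =>
      some ([((l, .lockAcq k), C)], none, nl, ⟨C.regrec, Θ.acqAsm k C.asmrec⟩)
  | .lockRel k =>
      some ([((l, .lockRel k), C)], none, nl,
        ⟨keep (Θ.exprStable (Θ.relAsm k C.asmrec)) C.regrec, Θ.relAsm k C.asmrec⟩)

/-- `compile-cmd-input-reqs C l nl c`. -/
def inputReqs (C : CompRec Val Var Lock Op Reg) (l : Option ℕ) (nl : ℕ)
    (c : Cmd Val Var Lock Op) : Prop :=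
  c ≠ .halt ∧ (∀ x, l = some x → x < nl) ∧ Θ.noUnstableExprs c C ∧ Θ.regrecStable C

/-- `compiled-cmd-config-consistent C regs mds mem`. -/
def configConsistent (C : CompRec Val Var Lock Op Reg) (regs : Reg → Val)
    (mds : MdsState Var Lock) (mem : Mem Val Var Lock) : Prop :=
  (∀ r e, C.regrec r = some e → regs r = e.ev Θ mem) ∧
    C.asmrec = (mds .AsmNoW, mds .AsmNoRW)

/-- The guards at the position `pc` of annotated code: there is an instruction at `pc`, and the
compilation record annotating it is stable and consistent with the configuration. -/
def guardsAt (PCs : List (LInstr Val Var Lock Op Reg × CompRec Val Var Lock Op Reg)) (pc : ℕ)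
    (regs : Reg → Val) (mds : MdsState Var Lock) (mem : Mem Val Var Lock) : Prop :=
  ∃ i Cpc, PCs[pc]? = some (i, Cpc) ∧
    Θ.configConsistent Cpc regs mds mem ∧ Θ.regrecStable Cpc

end Params

/-! ### Joinable programs -/

/-- `P` contains a jump to `l`. -/
def jumpsTo (P : List (LInstr Val Var Lock Op Reg)) (l : ℕ) : Prop :=
  ∃ i ∈ P, i.2 = .jmp l ∨ ∃ r, i.2 = .jz l r

/-- `l` labels an instruction of `P`. -/
def labels (P : List (LInstr Val Var Lock Op Reg)) (l : ℕ) : Prop :=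
  ∃ i ∈ P, i.1 = some l

/-- `P₁` jumps only to its own labels and to the label of the first instruction of `P₂`. -/
def joinableForward (P₁ P₂ : List (LInstr Val Var Lock Op Reg)) : Prop :=
  ∀ l, jumpsTo P₁ l → labels P₁ l ∨ ∃ i, P₂.head? = some (some l, i)

/-- `P₂` does not jump to labels of instructions of `P₁`. -/
def joinableBackward (P₁ P₂ : List (LInstr Val Var Lock Op Reg)) : Prop :=
  ∀ l, jumpsTo P₂ l → ¬ labels P₁ l

def joinable (P₁ P₂ : List (LInstr Val Var Lock Op Reg)) : Prop :=
  joinableForward P₁ P₂ ∧ joinableBackward P₁ P₂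

/-! ### The pacing function -/

/-- `leftmost-cmd`. -/
def leftmostCmd : Cmd Val Var Lock Op → Cmd Val Var Lock Op
  | .seq c₁ _ => leftmostCmd c₁
  | c => c

/-- `0`, unless the leftmost command is a loop, which then unfolds. -/
def exprPace (c : Cmd Val Var Lock Op) : ℕ :=
  match leftmostCmd c with
  | .while _ _ => 1
  | _ => 0

/-- `abs-steps_wr`. (The value is irrelevant when `RISC` has no instruction to execute.) -/
def absSteps (lcw : WConf Val Var Lock Op) (lcr : RConf Val Var Lock Op Reg) : ℕ :=
  match lcr.tps.text[lcr.tps.pc]? with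
  | none => 0
  | some (_, .load _ _) => exprPace lcw.tps
  | some (_, .op _ _ _) => exprPace lcw.tps
  | some (_, .moveK _ _) => exprPace lcw.tps
  | some (_, .jmp _) => 0
  | some (_, .nopEpi) => 0
  | some _ => 1

/-- The instructions used for silent control flow at the end of a compiled program. -/
def isEpilogue : Instr Val Var Lock Op Reg → Prop
  | .jmp _ => True
  | .nopEpi => True
  | _ => False

/-- Exactly `n` steps of `step`. -/
def nSteps {α : Type*} (step : α → α → Prop) : ℕ → α → α → Prop
  | 0, a, b => a = b
  | n + 1, a, b => ∃ a', step a a' ∧ nSteps step n a' b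

open Classical in
/-- What remains of `c₁ ; c₂` when `c₁` is what remains of its first component. -/
noncomputable def seqRest (c₁ c₂ : Cmd Val Var Lock Op) : Cmd Val Var Lock Op :=
  if c₁ = .halt then c₂ else .seq c₁ c₂

/-! ### The refinement relation -/

namespace Params

variable (Θ : Params Val Var Lock Op Reg)

/-- The refinement relation `R_wr`. -/
inductive Rwr : WConf Val Var Lock Op → RConf Val Var Lock Op Reg → Prop
  | halt (P regs mds mem) :
      Rwr ⟨.halt, mds, mem⟩ ⟨⟨P.length, P, regs⟩, mds, mem⟩
  | skip_nop (C l nl PCs l' nl' C' regs mds mem) :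
      Θ.inputReqs C l nl .skip →
      Θ.compileCmd C l nl .skip = some (PCs, l', nl', C') →
      Θ.guardsAt PCs 0 regs mds mem →
      Rwr ⟨.skip, mds, mem⟩ ⟨⟨0, PCs.map Prod.fst, regs⟩, mds, mem⟩
  | assign_expr (C l nl v e PCs l' nl' C' Pe r C₁ pc regs mds mem) :
      Θ.inputReqs C l nl (.assign v e) →
      Θ.compileCmd C l nl (.assign v e) = some (PCs, l', nl', C') →
      Θ.compileExpr C ∅ l e = some (Pe, r, C₁) →
      pc < Pe.length →
      Θ.guardsAt PCs pc regs mds mem →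
      Rwr ⟨.assign v e, mds, mem⟩ ⟨⟨pc, PCs.map Prod.fst, regs⟩, mds, mem⟩
  | assign_store (C l nl v e PCs l' nl' C' Pe r C₁ regs mds mem) :
      Θ.inputReqs C l nl (.assign v e) →
      Θ.compileCmd C l nl (.assign v e) = some (PCs, l', nl', C') →
      Θ.compileExpr C ∅ l e = some (Pe, r, C₁) →
      Θ.writeSafe C₁.asmrec v →
      Θ.guardsAt PCs Pe.length regs mds mem →
      Rwr ⟨.assign v e, mds, mem⟩ ⟨⟨Pe.length, PCs.map Prod.fst, regs⟩, mds, mem⟩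
  | lock_acq (C l nl k PCs l' nl' C' regs mds mem) :
      Θ.inputReqs C l nl (.lockAcq k) →
      Θ.compileCmd C l nl (.lockAcq k) = some (PCs, l', nl', C') →
      Θ.guardsAt PCs 0 regs mds mem →
      Rwr ⟨.lockAcq k, mds, mem⟩ ⟨⟨0, PCs.map Prod.fst, regs⟩, mds, mem⟩
  | lock_rel (C l nl k PCs l' nl' C' regs mds mem) :
      Θ.inputReqs C l nl (.lockRel k) →
      Θ.compileCmd C l nl (.lockRel k) = some (PCs, l', nl', C') →
      Θ.guardsAt PCs 0 regs mds mem →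
      Rwr ⟨.lockRel k, mds, mem⟩ ⟨⟨0, PCs.map Prod.fst, regs⟩, mds, mem⟩
  | seq (C l nl c₁ c₂ P₁ l₁ nl₁ C₁ P₂ l₂ nl₂ C₂ c₁' pc regs mds mem) :
      Θ.inputReqs C l nl (.seq c₁ c₂) →
      Θ.compileCmd C l nl c₁ = some (P₁, l₁, nl₁, C₁) →
      Θ.compileCmd C₁ l₁ nl₁ c₂ = some (P₂, l₂, nl₂, C₂) →
      joinable (P₁.map Prod.fst) (P₂.map Prod.fst) →
      pc < P₁.length →
      Θ.guardsAt P₁ pc regs mds mem →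
      Rwr ⟨c₁', mds, mem⟩ ⟨⟨pc, P₁.map Prod.fst, regs⟩, mds, mem⟩ →
      (∀ mds' mem' regs', Θ.configConsistent C₁ regs' mds' mem' → Θ.regrecStable C₁ →
        Rwr ⟨c₂, mds', mem'⟩ ⟨⟨0, P₂.map Prod.fst, regs'⟩, mds', mem'⟩) →
      Rwr ⟨seqRest c₁' c₂, mds, mem⟩
        ⟨⟨pc, P₁.map Prod.fst ++ P₂.map Prod.fst, regs⟩, mds, mem⟩
  | join (c P₁ P₂ pc regs mds mem) :
      joinable P₁ P₂ →
      P₁.length ≤ pc →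
      Rwr ⟨c, mds, mem⟩ ⟨⟨pc - P₁.length, P₂, regs⟩, mds, mem⟩ →
      Rwr ⟨c, mds, mem⟩ ⟨⟨pc, P₁ ++ P₂, regs⟩, mds, mem⟩
  | if_expr (C l nl e c₁ c₂ PCs l' C' Pe r C₁ P₁ l₁ nl₁ C₂ P₂ l₂ nl₂ C₃ pc regs mds mem) :
      Θ.inputReqs C l nl (.ite e c₁ c₂) →
      Θ.compileCmd C l nl (.ite e c₁ c₂) = some (PCs, l', nl₂, C') →
      Θ.compileExpr C ∅ l e = some (Pe, r, C₁) →
      Θ.compileCmd C₁ none (nl + 2) c₁ = some (P₁, l₁, nl₁, C₂) →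
      Θ.compileCmd C₁ (some nl) nl₁ c₂ = some (P₂, l₂, nl₂, C₃) →
      pc ≤ Pe.length →
      Θ.guardsAt PCs pc regs mds mem →
      (∀ mds' mem' regs', Θ.configConsistent C₁ regs' mds' mem' → Θ.regrecStable C₁ →
        Rwr ⟨c₁, mds', mem'⟩ ⟨⟨0, P₁.map Prod.fst, regs'⟩, mds', mem'⟩) →
      (∀ mds' mem' regs', Θ.configConsistent C₁ regs' mds' mem' → Θ.regrecStable C₁ →
        Rwr ⟨c₂, mds', mem'⟩ ⟨⟨0, P₂.map Prod.fst, regs'⟩, mds', mem'⟩) →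
      Rwr ⟨.ite e c₁ c₂, mds, mem⟩ ⟨⟨pc, PCs.map Prod.fst, regs⟩, mds, mem⟩
  | if_c1 (C l nl e c₁ c₂ PCs l' C' Pe r C₁ P₁ l₁ nl₁ C₂ P₂ l₂ nl₂ C₃ c₁' pc regs mds mem) :
      Θ.inputReqs C l nl (.ite e c₁ c₂) →
      Θ.compileCmd C l nl (.ite e c₁ c₂) = some (PCs, l', nl₂, C') →
      Θ.compileExpr C ∅ l e = some (Pe, r, C₁) →
      Θ.compileCmd C₁ none (nl + 2) c₁ = some (P₁, l₁, nl₁, C₂) →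
      Θ.compileCmd C₁ (some nl) nl₁ c₂ = some (P₂, l₂, nl₂, C₃) →
      pc < P₁.length →
      Θ.guardsAt PCs (Pe.length + 1 + pc) regs mds mem →
      Rwr ⟨c₁', mds, mem⟩ ⟨⟨pc, P₁.map Prod.fst, regs⟩, mds, mem⟩ →
      Rwr ⟨c₁', mds, mem⟩
        ⟨⟨Pe.length + 1 + pc, PCs.map Prod.fst, regs⟩, mds, mem⟩
  | if_c2 (C l nl e c₁ c₂ PCs l' C' Pe r C₁ P₁ l₁ nl₁ C₂ P₂ l₂ nl₂ C₃ c₂' pc regs mds mem) :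
      Θ.inputReqs C l nl (.ite e c₁ c₂) →
      Θ.compileCmd C l nl (.ite e c₁ c₂) = some (PCs, l', nl₂, C') →
      Θ.compileExpr C ∅ l e = some (Pe, r, C₁) →
      Θ.compileCmd C₁ none (nl + 2) c₁ = some (P₁, l₁, nl₁, C₂) →
      Θ.compileCmd C₁ (some nl) nl₁ c₂ = some (P₂, l₂, nl₂, C₃) →
      pc < P₂.length →
      Θ.guardsAt PCs (Pe.length + 1 + P₁.length + 1 + pc) regs mds mem →
      Rwr ⟨c₂', mds, mem⟩ ⟨⟨pc, P₂.map Prod.fst, regs⟩, mds, mem⟩ →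
      Rwr ⟨c₂', mds, mem⟩
        ⟨⟨Pe.length + 1 + P₁.length + 1 + pc, PCs.map Prod.fst, regs⟩, mds, mem⟩
  | epilogue_step (P lo i pc regs mds mem) :
      P[pc]? = some (lo, i) →
      isEpilogue i →
      (∀ lcw' lcr', Θ.RStep ⟨⟨pc, P, regs⟩, mds, mem⟩ lcr' →
        nSteps Θ.WStep (absSteps ⟨.halt, mds, mem⟩
          (⟨⟨pc, P, regs⟩, mds, mem⟩ : RConf Val Var Lock Op Reg)) ⟨.halt, mds, mem⟩ lcw' →
        Rwr lcw' lcr') →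
      Rwr ⟨.halt, mds, mem⟩ ⟨⟨pc, P, regs⟩, mds, mem⟩
  | while_expr (C l nl e c PCs l' nl' C' Pe r C₁ Pc lc nlc C₂ cw pc regs mds mem) :
      Θ.inputReqs C l nl (.while e c) →
      Θ.compileCmd C l nl (.while e c) = some (PCs, l', nl', C') →
      Θ.compileExpr ⟨fun _ => none, C.asmrec⟩ ∅ (some (l.getD nl)) e = some (Pe, r, C₁) →
      Θ.compileCmd C₁ none (nl + 2) c = some (Pc, lc, nlc, C₂) →
      pc ≤ Pe.length →
      (pc = 0 ∧ cw = .while e c ∨ 0 < pc ∧ cw = .ite e (.seq c (.while e c)) .halt) →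
      Θ.guardsAt PCs pc regs mds mem →
      (∀ mds' mem' regs', Θ.configConsistent C₁ regs' mds' mem' → Θ.regrecStable C₁ →
        Rwr ⟨c, mds', mem'⟩ ⟨⟨0, Pc.map Prod.fst, regs'⟩, mds', mem'⟩) →
      Rwr ⟨cw, mds, mem⟩ ⟨⟨pc, PCs.map Prod.fst, regs⟩, mds, mem⟩
  | while_inner (C l nl e c PCs l' nl' C' Pe r C₁ Pc lc nlc C₂ cI pc regs mds mem) :
      Θ.inputReqs C l nl (.while e c) →
      Θ.compileCmd C l nl (.while e c) = some (PCs, l', nl', C') →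
      Θ.compileExpr ⟨fun _ => none, C.asmrec⟩ ∅ (some (l.getD nl)) e = some (Pe, r, C₁) →
      Θ.compileCmd C₁ none (nl + 2) c = some (Pc, lc, nlc, C₂) →
      pc < Pc.length →
      cI ≠ .halt →
      Θ.guardsAt PCs (Pe.length + 1 + pc) regs mds mem →
      Rwr ⟨cI, mds, mem⟩ ⟨⟨pc, Pc.map Prod.fst, regs⟩, mds, mem⟩ →
      (∀ mds' mem' regs', Θ.configConsistent C₁ regs' mds' mem' → Θ.regrecStable C₁ →
        Rwr ⟨c, mds', mem'⟩ ⟨⟨0, Pc.map Prod.fst, regs'⟩, mds', mem'⟩) →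
      Rwr ⟨.seq cI (.while e c), mds, mem⟩
        ⟨⟨Pe.length + 1 + pc, PCs.map Prod.fst, regs⟩, mds, mem⟩
  | while_loop (C l nl e c PCs l' nl' C' Pe r C₁ Pc lc nlc C₂ pc regs mds mem) :
      Θ.inputReqs C l nl (.while e c) →
      Θ.compileCmd C l nl (.while e c) = some (PCs, l', nl', C') →
      Θ.compileExpr ⟨fun _ => none, C.asmrec⟩ ∅ (some (l.getD nl)) e = some (Pe, r, C₁) →
      Θ.compileCmd C₁ none (nl + 2) c = some (Pc, lc, nlc, C₂) →
      pc ≤ Pc.length →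
      Θ.guardsAt PCs (Pe.length + 1 + pc) regs mds mem →
      Rwr ⟨.halt, mds, mem⟩ ⟨⟨pc, Pc.map Prod.fst, regs⟩, mds, mem⟩ →
      (∀ mds' mem' regs', Θ.configConsistent C₁ regs' mds' mem' → Θ.regrecStable C₁ →
        Rwr ⟨c, mds', mem'⟩ ⟨⟨0, Pc.map Prod.fst, regs'⟩, mds', mem'⟩) →
      Rwr ⟨.while e c, mds, mem⟩
        ⟨⟨Pe.length + 1 + pc, PCs.map Prod.fst, regs⟩, mds, mem⟩

end Params

end

end WRCompiler

namespace WRCompiler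

universe u₁ u₂ u₃ u₄ u₅

section

variable {Val : Type u₁} {Var : Type u₂} {Lock : Type u₃} {Op : Type u₄} {Reg : Type u₅}

/-! The proof is an induction on the derivation of the refinement relation. Each rule places a
command at a position of compiled code, and one RISC step from that position must lead to a
configuration to which some rule applies again. Three questions recur in every case.

The first concerns control flow: a step in a piece of code has to be the same step when the piece is
surrounded by more code. Only jumps depend on the program text. An unresolved label resolves to the
end of the text, and the exit label of a piece is the entry label of what follows it, so leaving a
piece means the same alone and in context. That labels do not clash is `compileCmd_labelSpec`, by
freshness of the counter; the resulting transport of steps is `RStep.of_context`, applied through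
`FragmentAt.step`, `RStep.of_append_left` and `RStep.of_append_right`.

The second concerns the guards: most rules demand that the record at the current position be stable
and consistent with the configuration, and the induction hypothesis on a subprogram says nothing
about this. It is a property of compiled code alone that a step from a valid annotation reaches a
valid one; this is `compileCmd_step`, with `compileExpr_exec` for expressions. The position after
the last instruction is included, annotated with the final record, because that is where control
passes on.

The third concerns pacing: the number of While steps depends on the instruction and on the leftmost
command, and both survive placing a command in front of a continuation, unless the command has
terminated. A terminated command is related to code that still has an instruction to run only if
that instruction is silent (`Rwr.isEpilogue_of_halt`), and silent instructions take no While steps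
whatever the command is.

When a subprogram reaches the end of its code, its command is `halt` (`Rwr.eq_halt`). Control then
passes to the next command, whose relation at its start is a premise of the rule, or to a silent
jump or no-op. The cases are assembled in `Rwr.simulates`. -/

@[simp] theorem upd_self {α β : Type*} (f : α → β) (a : α) (b : β) : upd f a b a = b := by
  simp [upd]

theorem upd_of_ne {α β : Type*} (f : α → β) {a x : α} (b : β) (h : x ≠ a) :
    upd f a b x = f x := by
  simp [upd, h]

/-! ### Jump resolution -/

theorem resolve_append_of_labels {P : List (LInstr Val Var Lock Op Reg)} {l : ℕ}
    (h : labels P l) (Q : List (LInstr Val Var Lock Op Reg)) :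
    resolve (P ++ Q) l = resolve P l := by
  obtain ⟨i, hi, hl⟩ := h
  unfold resolve
  rw [List.findIdx_append, if_pos]
  exact List.findIdx_lt_length_of_exists ⟨i, hi, by simp [hl]⟩

theorem resolve_of_not_labels {P : List (LInstr Val Var Lock Op Reg)} {l : ℕ}
    (h : ¬ labels P l) : resolve P l = P.length := by
  unfold resolve
  rw [List.findIdx_eq_length]
  intro i hi
  simp only [beq_eq_false_iff_ne]
  exact fun hl => h ⟨i, hi, hl⟩

theorem resolve_append_of_not_labels {P : List (LInstr Val Var Lock Op Reg)} {l : ℕ}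
    (h : ¬ labels P l) (Q : List (LInstr Val Var Lock Op Reg)) :
    resolve (P ++ Q) l = P.length + resolve Q l := by
  have := resolve_of_not_labels h
  unfold resolve at *
  rw [List.findIdx_append, this, if_neg (lt_irrefl _), add_comm]

theorem resolve_of_head {P : List (LInstr Val Var Lock Op Reg)} {l : ℕ}
    (h : ∃ i, P.head? = some (some l, i)) : resolve P l = 0 := by
  obtain ⟨i, hi⟩ := h
  cases P with
  | nil => simp at hi
  | cons a P =>
    simp only [List.head?_cons, Option.some.injEq] at hi
    simp [resolve, hi, List.findIdx_cons]

/-- A target missing from `P` resolves to the end of `P` when `P` stands alone. In `P ++ Q` it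
labels the first instruction of `Q`, which sits at that very position. -/
theorem resolve_append_of_joinableForward {P Q : List (LInstr Val Var Lock Op Reg)}
    (h : joinableForward P Q) {l : ℕ} (hl : jumpsTo P l) :
    resolve (P ++ Q) l = resolve P l := by
  by_cases hP : labels P l
  · exact resolve_append_of_labels hP Q
  · rw [resolve_append_of_not_labels hP, resolve_of_not_labels hP,
      resolve_of_head ((h l hl).resolve_left hP), add_zero]

theorem labels_append {P Q : List (LInstr Val Var Lock Op Reg)} {l : ℕ} :
    labels (P ++ Q) l ↔ labels P l ∨ labels Q l := by
  simp only [labels, List.mem_append, or_and_right, exists_or]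

theorem labels_cons {a : LInstr Val Var Lock Op Reg} {P : List (LInstr Val Var Lock Op Reg)}
    {l : ℕ} : labels (a :: P) l ↔ a.1 = some l ∨ labels P l := by
  simp [labels]

@[simp] theorem not_labels_nil {l : ℕ} :
    ¬ labels ([] : List (LInstr Val Var Lock Op Reg)) l := by
  simp [labels]

theorem jumpsTo_append {P Q : List (LInstr Val Var Lock Op Reg)} {l : ℕ} :
    jumpsTo (P ++ Q) l ↔ jumpsTo P l ∨ jumpsTo Q l := by
  simp only [jumpsTo, List.mem_append, or_and_right, exists_or]

theorem jumpsTo_cons {a : LInstr Val Var Lock Op Reg} {P : List (LInstr Val Var Lock Op Reg)}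
    {l : ℕ} : jumpsTo (a :: P) l ↔ (a.2 = .jmp l ∨ ∃ r, a.2 = .jz l r) ∨ jumpsTo P l := by
  simp [jumpsTo]

@[simp] theorem not_jumpsTo_nil {l : ℕ} :
    ¬ jumpsTo ([] : List (LInstr Val Var Lock Op Reg)) l := by
  simp [jumpsTo]

/-! ### Annotations -/

/-- The record annotating position `pc`, where the position after the last instruction is
annotated with the final record `C`. -/
def annot (PCs : List (LInstr Val Var Lock Op Reg × CompRec Val Var Lock Op Reg))
    (C : CompRec Val Var Lock Op Reg) (pc : ℕ) : Option (CompRec Val Var Lock Op Reg) :=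
  (PCs.map Prod.snd ++ [C])[pc]?

section annot

variable {P Q : List (LInstr Val Var Lock Op Reg × CompRec Val Var Lock Op Reg)}
  {C D : CompRec Val Var Lock Op Reg} {pc : ℕ}

@[simp] theorem annot_nil_zero : annot [] C 0 =
    (some C : Option (CompRec Val Var Lock Op Reg)) := rfl

@[simp] theorem annot_cons_zero {a : LInstr Val Var Lock Op Reg × CompRec Val Var Lock Op Reg} :
    annot (a :: P) C 0 = some a.2 := rfl

theorem annot_of_getElem? {i : LInstr Val Var Lock Op Reg} (h : P[pc]? = some (i, D)) :
    annot P C pc = some D := by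
  have hlt : pc < P.length := by
    by_contra hn
    rw [List.getElem?_eq_none (by omega)] at h
    cases h
  rw [annot, List.getElem?_append_left (by simpa using hlt), List.getElem?_map, h]
  rfl

theorem annot_length : annot P C P.length = some C := by
  simp [annot]

theorem le_length_of_annot (h : annot P C pc = some D) : pc ≤ P.length := by
  by_contra hn
  rw [annot, List.getElem?_eq_none (by simp; omega)] at h
  cases h

theorem getElem?_of_annot (h : annot P C pc = some D) (hpc : pc < P.length) :
    ∃ i, P[pc]? = some (i, D) := by
  rw [annot, List.getElem?_append_left (by simpa using hpc), List.getElem?_map] at h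
  obtain ⟨⟨i, E⟩, hi, hE⟩ := Option.map_eq_some_iff.1 h
  exact ⟨i, by rw [hi]; cases hE; rfl⟩

/-- The boundary `pc = P.length` is included: there the concatenation shows the first annotation of
`Q`, so this annotation has to play the part of the final record of `P`. -/
theorem annot_append_left (h : annot Q C 0 = some D) (hpc : pc ≤ P.length) :
    annot (P ++ Q) C pc = annot P D pc := by
  rcases hpc.lt_or_eq with hlt | rfl
  · simp only [annot, List.map_append, List.append_assoc]
    rw [List.getElem?_append_left (by simpa using hlt),
      List.getElem?_append_left (by simpa using hlt)]
  · rw [annot_length, ← h]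
    simp only [annot, List.map_append, List.append_assoc]
    rw [List.getElem?_append_right (by simp)]
    simp

theorem annot_append_right : annot (P ++ Q) C (P.length + pc) = annot Q C pc := by
  simp only [annot, List.map_append, List.append_assoc]
  rw [List.getElem?_append_right (by simp)]
  simp

end annot

namespace Params

variable {Θ : Params Val Var Lock Op Reg}

/-- The record annotating `pc` is stable and consistent with the configuration. -/
def okAt (Θ : Params Val Var Lock Op Reg)
    (PCs : List (LInstr Val Var Lock Op Reg × CompRec Val Var Lock Op Reg))
    (C : CompRec Val Var Lock Op Reg) (pc : ℕ) (regs : Reg → Val) (mds : MdsState Var Lock)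
    (mem : Mem Val Var Lock) : Prop :=
  ∃ D, annot PCs C pc = some D ∧ Θ.configConsistent D regs mds mem ∧ Θ.regrecStable D

/-! ### Valid annotations, including the end of the code. -/

section okAt

variable {P Q : List (LInstr Val Var Lock Op Reg × CompRec Val Var Lock Op Reg)}
  {C D : CompRec Val Var Lock Op Reg} {pc : ℕ} {regs : Reg → Val} {mds : MdsState Var Lock}
  {mem : Mem Val Var Lock}

theorem guardsAt.okAt (h : Θ.guardsAt P pc regs mds mem) (C : CompRec Val Var Lock Op Reg) :
    Θ.okAt P C pc regs mds mem := by
  obtain ⟨i, D, hi, hD⟩ := h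
  exact ⟨D, annot_of_getElem? hi, hD⟩

theorem guardsAt.lt_length (h : Θ.guardsAt P pc regs mds mem) : pc < P.length := by
  obtain ⟨i, D, hi, hD⟩ := h
  by_contra hn
  rw [List.getElem?_eq_none (by omega)] at hi
  cases hi

theorem okAt.guardsAt (h : Θ.okAt P C pc regs mds mem) (hpc : pc < P.length) :
    Θ.guardsAt P pc regs mds mem := by
  obtain ⟨D, hD, h⟩ := h
  obtain ⟨i, hi⟩ := getElem?_of_annot hD hpc
  exact ⟨i, D, hi, h⟩

theorem okAt.le_length (h : Θ.okAt P C pc regs mds mem) : pc ≤ P.length :=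
  le_length_of_annot h.choose_spec.1

theorem okAt_length :
    Θ.okAt P C P.length regs mds mem ↔ Θ.configConsistent C regs mds mem ∧ Θ.regrecStable C := by
  simp [Params.okAt, annot_length]

theorem okAt_append_right :
    Θ.okAt (P ++ Q) C (P.length + pc) regs mds mem ↔ Θ.okAt Q C pc regs mds mem := by
  simp only [Params.okAt, annot_append_right]

theorem okAt_append_left (h : annot Q C 0 = some D) (hpc : pc ≤ P.length) :
    Θ.okAt (P ++ Q) C pc regs mds mem ↔ Θ.okAt P D pc regs mds mem := by
  simp only [Params.okAt, annot_append_left h hpc]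

/-- Transport from a code fragment to code in which it is followed by an instruction annotated
with its final record. -/
theorem okAt_context {A B : List (LInstr Val Var Lock Op Reg × CompRec Val Var Lock Op Reg)}
    {i : LInstr Val Var Lock Op Reg} (hpc : pc ≤ Q.length) :
    Θ.okAt (A ++ (Q ++ (i, D) :: B)) C (A.length + pc) regs mds mem ↔
      Θ.okAt Q D pc regs mds mem := by
  rw [okAt_append_right, okAt_append_left annot_cons_zero hpc]

end okAt

/-! ### Steps within a context -/

/-- Apart from jumps, every instruction acts relative to its position, so the context only shifts
it. For jumps, `hA` keeps the search for the target from stopping in the prefix, and `hB` makes the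
suffix irrelevant to it. -/
theorem Exec.of_context {A Q B : List (LInstr Val Var Lock Op Reg)}
    {i : Instr Val Var Lock Op Reg} {pc pc' regs regs' mds mds' mem mem'}
    (hA : ∀ l, jumpsTo Q l → ¬ labels A l)
    (hB : ∀ l, jumpsTo Q l → resolve (Q ++ B) l = resolve Q l)
    {lo : Option ℕ} (hi : (lo, i) ∈ Q)
    (h : Θ.Exec (A ++ (Q ++ B)) i (A.length + pc) regs mds mem pc' regs' mds' mem') :
    ∃ q', pc' = A.length + q' ∧ Θ.Exec Q i pc regs mds mem q' regs' mds' mem' := by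
  generalize hn : A.length + pc = n at h
  have key : ∀ l, jumpsTo Q l → resolve (A ++ (Q ++ B)) l = A.length + resolve Q l :=
    fun l hl => by rw [resolve_append_of_not_labels (hA l hl), hB l hl]
  cases h with
  | load r v => exact ⟨pc + 1, by omega, .load ..⟩
  | store r v => exact ⟨pc + 1, by omega, .store ..⟩
  | jmp l => exact ⟨_, key l ⟨_, hi, .inl rfl⟩, .jmp ..⟩
  | jz_jump l r _ _ _ _ ht => exact ⟨_, key l ⟨_, hi, .inr ⟨r, rfl⟩⟩, .jz_jump _ _ _ _ _ _ ht⟩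
  | jz_next l r _ _ _ _ ht => exact ⟨pc + 1, by omega, .jz_next _ _ _ _ _ _ ht⟩
  | nop => exact ⟨pc + 1, by omega, .nop ..⟩
  | nopEpi => exact ⟨pc + 1, by omega, .nopEpi ..⟩
  | moveK r n => exact ⟨pc + 1, by omega, .moveK ..⟩
  | moveR r r' => exact ⟨pc + 1, by omega, .moveR ..⟩
  | op o r r' => exact ⟨pc + 1, by omega, .op ..⟩
  | lockAcq k _ _ _ _ hk => exact ⟨pc + 1, by omega, .lockAcq _ _ _ _ _ hk⟩
  | lockAcq_spin k _ _ _ _ hk => exact ⟨pc, by omega, .lockAcq_spin _ _ _ _ _ hk⟩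
  | lockRel k _ _ _ _ hk => exact ⟨pc + 1, by omega, .lockRel _ _ _ _ _ hk⟩
  | lockRel_spin k _ _ _ _ hk => exact ⟨pc, by omega, .lockRel_spin _ _ _ _ _ hk⟩

theorem RStep.exec {P : List (LInstr Val Var Lock Op Reg)} {pc regs mds mem lcr'}
    {lo : Option ℕ} {i : Instr Val Var Lock Op Reg}
    (h : Θ.RStep ⟨⟨pc, P, regs⟩, mds, mem⟩ lcr') (hi : P[pc]? = some (lo, i)) :
    ∃ pc' regs' mds' mem', lcr' = ⟨⟨pc', P, regs'⟩, mds', mem'⟩ ∧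
      Θ.Exec P i pc regs mds mem pc' regs' mds' mem' := by
  cases h with
  | mk P lo' i' pc regs mds mem pc' regs' mds' mem' hi' hx =>
    rw [hi] at hi'
    cases hi'
    exact ⟨_, _, _, _, rfl, hx⟩

theorem getElem?_context {α : Type*} {A Q B : List α} {pc : ℕ} (hpc : pc < Q.length) :
    (A ++ (Q ++ B))[A.length + pc]? = Q[pc]? := by
  rw [List.getElem?_append_right (by omega), List.getElem?_append_left (by omega)]
  simp

theorem RStep.of_context {A Q B : List (LInstr Val Var Lock Op Reg)} {pc regs mds mem lcr'}
    (hA : ∀ l, jumpsTo Q l → ¬ labels A l)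
    (hB : ∀ l, jumpsTo Q l → resolve (Q ++ B) l = resolve Q l)
    (hpc : pc < Q.length)
    (h : Θ.RStep ⟨⟨A.length + pc, A ++ (Q ++ B), regs⟩, mds, mem⟩ lcr') :
    ∃ q' regs' mds' mem', lcr' = ⟨⟨A.length + q', A ++ (Q ++ B), regs'⟩, mds', mem'⟩ ∧
      Θ.RStep ⟨⟨pc, Q, regs⟩, mds, mem⟩ ⟨⟨q', Q, regs'⟩, mds', mem'⟩ := by
  have hi : Q[pc]? = some Q[pc] := List.getElem?_eq_getElem hpc
  obtain ⟨pc', regs', mds', mem', rfl, hx⟩ := h.exec ((getElem?_context hpc).trans hi)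
  obtain ⟨q', rfl, hx'⟩ := hx.of_context hA hB (List.getElem_mem hpc)
  exact ⟨q', regs', mds', mem', rfl, .mk _ _ _ _ _ _ _ _ _ _ _ hi hx'⟩

/-! ### Consistency and stability of records -/

section records

variable {C : CompRec Val Var Lock Op Reg} {regs : Reg → Val} {mds : MdsState Var Lock}
  {mem : Mem Val Var Lock}

/-- Recorded expressions mention no registers, so writing a register affects no entry but its own.
-/
theorem configConsistent.upd (h : Θ.configConsistent C regs mds mem) (r : Reg)
    (e : Expr Val Var Op) {n : Val} (hn : n = e.ev Θ mem) :
    Θ.configConsistent ⟨upd C.regrec r (some e), C.asmrec⟩ (upd regs r n) mds mem := by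
  refine ⟨fun r' e' he => ?_, h.2⟩
  by_cases hr : r' = r
  · subst hr
    simp only [upd_self, Option.some.injEq] at he ⊢
    rw [hn, he]
  · simp only [upd_of_ne _ _ hr] at he ⊢
    exact h.1 r' e' he

theorem regrecStable.upd (h : Θ.regrecStable C) (r : Reg) {e : Expr Val Var Op}
    (he : Θ.exprStable C.asmrec e) :
    Θ.regrecStable ⟨upd C.regrec r (some e), C.asmrec⟩ := by
  intro r' e' he'
  by_cases hr : r' = r
  · subst hr
    simp only [upd_self, Option.some.injEq] at he'
    exact he' ▸ he
  · simp only [upd_of_ne _ _ hr] at he'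
    exact h r' e' he'

theorem keep_eq_some {p : Expr Val Var Op → Prop} {Φ : RegRec Val Var Op Reg} {r : Reg}
    {e : Expr Val Var Op} : keep p Φ r = some e ↔ Φ r = some e ∧ p e := by
  simp [keep, Option.filter_eq_some_iff]

theorem meet_eq_some {Φ Φ' : RegRec Val Var Op Reg} {r : Reg} {e : Expr Val Var Op} :
    meet Φ Φ' r = some e ↔ Φ r = some e ∧ Φ' r = some e := by
  unfold meet
  split
  · rename_i h; rw [← h]; simp
  · rename_i h
    simp only [reduceCtorEq, false_iff]
    rintro ⟨h₁, h₂⟩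
    exact h (h₁.trans h₂.symm)

theorem ev_congr {e : Expr Val Var Op} {mem mem' : Mem Val Var Lock}
    (h : ∀ v ∈ e.vars, mem (.prog v) = mem' (.prog v)) : e.ev Θ mem = e.ev Θ mem' := by
  induction e with
  | const n => rfl
  | var v => exact h v rfl
  | bin o e₁ e₂ ih₁ ih₂ =>
    simp only [Expr.ev, ih₁ fun v hv => h v (.inl hv), ih₂ fun v hv => h v (.inr hv)]

end records

/-! ### Compilation of expressions -/

/-- The instructions emitted in the compilation of expressions. -/
def _root_.WRCompiler.isExprInstr : Instr Val Var Lock Op Reg → Prop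
  | .load _ _ => True
  | .moveK _ _ => True
  | .op _ _ _ => True
  | _ => False

section expr

variable {C : CompRec Val Var Lock Op Reg} {A : Set Reg} {l : Option ℕ} {e : Expr Val Var Op}
  {P : List (LInstr Val Var Lock Op Reg × CompRec Val Var Lock Op Reg)} {r : Reg}
  {C' : CompRec Val Var Lock Op Reg}

theorem compileExpr_const {n : Val} (h : Θ.compileExpr C A l (.const n) = some (P, r, C')) :
    Θ.regAlloc C.regrec A = some r ∧ P = [((l, .moveK r n), C)] ∧
      C' = ⟨upd C.regrec r (some (.const n)), C.asmrec⟩ := by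
  unfold compileExpr at h
  split at h
  · cases h
  · cases h; exact ⟨by assumption, rfl, rfl⟩

theorem compileExpr_var {v : Var} (h : Θ.compileExpr C A l (.var v) = some (P, r, C')) :
    (Θ.regAllocCached C.regrec A v = some r ∧ P = [] ∧ C' = C) ∨
    (Θ.regAlloc C.regrec A = some r ∧ P = [((l, .load r v), C)] ∧
      C' = ⟨upd C.regrec r (some (.var v)), C.asmrec⟩) := by
  unfold compileExpr at h
  split at h
  · cases h; exact .inl ⟨by assumption, rfl, rfl⟩
  · split at h
    · cases h
    · cases h; exact .inr ⟨by assumption, rfl, rfl⟩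

open Classical in
theorem compileExpr_bin {o : Op} {e₁ e₂ : Expr Val Var Op}
    (h : Θ.compileExpr C A l (.bin o e₁ e₂) = some (P, r, C')) :
    ∃ P₁ C₁ P₂ r₂ C₂, Θ.compileExpr C A l e₁ = some (P₁, r, C₁) ∧
      Θ.compileExpr C₁ (A ∪ {r}) (if P₁ = [] then l else none) e₂ = some (P₂, r₂, C₂) ∧
      P = P₁ ++ (P₂ ++ [((if P₁ ++ P₂ = [] then l else none, .op o r r₂), C₂)]) ∧
      C' = ⟨upd C₂.regrec r (some (.bin o e₁ e₂)), C₂.asmrec⟩ := by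
  rw [compileExpr] at h
  split at h
  · cases h
  · split at h
    · cases h
    · rename_i h₁ _ _ _ _ h₂
      cases h
      exact ⟨_, _, _, _, _, h₁, h₂, by simp, rfl⟩

theorem compileExpr_asmrec (h : Θ.compileExpr C A l e = some (P, r, C')) :
    C'.asmrec = C.asmrec := by
  induction e generalizing C A l P r C' with
  | const n => obtain ⟨-, -, rfl⟩ := compileExpr_const h; rfl
  | var v => obtain ⟨-, -, rfl⟩ | ⟨-, -, rfl⟩ := compileExpr_var h <;> rfl
  | bin o e₁ e₂ ih₁ ih₂ =>
    obtain ⟨P₁, C₁, P₂, r₂, C₂, h₁, h₂, -, rfl⟩ := compileExpr_bin h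
    exact (ih₂ h₂).trans (ih₁ h₁)

theorem compileExpr_notMem (h : Θ.compileExpr C A l e = some (P, r, C')) : r ∉ A := by
  induction e generalizing C A l P r C' with
  | const n => exact Θ.regAlloc_notMem _ _ _ (compileExpr_const h).1
  | var v =>
    obtain ⟨h, -⟩ | ⟨h, -⟩ := compileExpr_var h
    · exact Θ.regAllocCached_notMem _ _ _ _ h
    · exact Θ.regAlloc_notMem _ _ _ h
  | bin o e₁ e₂ ih₁ ih₂ =>
    obtain ⟨P₁, C₁, P₂, r₂, C₂, h₁, -⟩ := compileExpr_bin h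
    exact ih₁ h₁

/-- Registers are always allocated outside the set in use. This keeps the value of a left operand
alive while the right operand is evaluated. -/
theorem compileExpr_regrec_of_mem (h : Θ.compileExpr C A l e = some (P, r, C')) {a : Reg}
    (ha : a ∈ A) : C'.regrec a = C.regrec a := by
  have hr : a ≠ r := fun hr => compileExpr_notMem h (hr ▸ ha)
  induction e generalizing C A l P r C' with
  | const n =>
    obtain ⟨-, -, rfl⟩ := compileExpr_const h
    exact upd_of_ne _ _ hr
  | var v =>
    obtain ⟨-, -, rfl⟩ | ⟨-, -, rfl⟩ := compileExpr_var h
    · rfl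
    · exact upd_of_ne _ _ hr
  | bin o e₁ e₂ ih₁ ih₂ =>
    obtain ⟨P₁, C₁, P₂, r₂, C₂, h₁, h₂, -, rfl⟩ := compileExpr_bin h
    refine (upd_of_ne _ _ hr).trans ((ih₂ h₂ (.inl ha) ?_).trans (ih₁ h₁ ha hr))
    exact fun h => compileExpr_notMem h₂ (h ▸ .inl ha)

theorem compileExpr_regrec (h : Θ.compileExpr C A l e = some (P, r, C')) :
    C'.regrec r = some e := by
  cases e with
  | const n => obtain ⟨-, -, rfl⟩ := compileExpr_const h; exact upd_self ..
  | var v =>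
    obtain ⟨h, -, rfl⟩ | ⟨-, -, rfl⟩ := compileExpr_var h
    · exact Θ.regAllocCached_eq _ _ _ _ h
    · exact upd_self ..
  | bin o e₁ e₂ =>
    obtain ⟨P₁, C₁, P₂, r₂, C₂, h₁, h₂, -, rfl⟩ := compileExpr_bin h
    exact upd_self ..

theorem compileExpr_regrecStable (h : Θ.compileExpr C A l e = some (P, r, C'))
    (he : Θ.exprStable C.asmrec e) (hC : Θ.regrecStable C) : Θ.regrecStable C' := by
  induction e generalizing C A l P r C' with
  | const n => obtain ⟨-, -, rfl⟩ := compileExpr_const h; exact hC.upd _ he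
  | var v =>
    obtain ⟨-, -, rfl⟩ | ⟨-, -, rfl⟩ := compileExpr_var h
    · exact hC
    · exact hC.upd _ he
  | bin o e₁ e₂ ih₁ ih₂ =>
    obtain ⟨P₁, C₁, P₂, r₂, C₂, h₁, h₂, -, rfl⟩ := compileExpr_bin h
    have ha₁ := compileExpr_asmrec h₁
    have ha₂ := compileExpr_asmrec h₂
    refine (ih₂ h₂ ?_ (ih₁ h₁ (fun v hv => he v (.inl hv)) hC)).upd _ ?_
    · rw [ha₁]; exact fun v hv => he v (.inr hv)
    · rw [ha₂, ha₁]; exact he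

theorem compileExpr_isExprInstr (h : Θ.compileExpr C A l e = some (P, r, C')) :
    ∀ i ∈ P, isExprInstr i.1.2 := by
  induction e generalizing C A l P r C' with
  | const n => obtain ⟨-, rfl, -⟩ := compileExpr_const h; simp [isExprInstr]
  | var v => obtain ⟨-, rfl, -⟩ | ⟨-, rfl, -⟩ := compileExpr_var h <;> simp [isExprInstr]
  | bin o e₁ e₂ ih₁ ih₂ =>
    obtain ⟨P₁, C₁, P₂, r₂, C₂, h₁, h₂, rfl, -⟩ := compileExpr_bin h
    intro i hi
    simp only [List.mem_append, List.mem_singleton] at hi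
    obtain hi | hi | rfl := hi
    · exact ih₁ h₁ i hi
    · exact ih₂ h₂ i hi
    · trivial

theorem compileExpr_not_jumpsTo (h : Θ.compileExpr C A l e = some (P, r, C')) (x : ℕ) :
    ¬ jumpsTo (P.map Prod.fst) x := by
  rintro ⟨i, hi, hx⟩
  obtain ⟨a, ha, rfl⟩ := List.mem_map.1 hi
  have := compileExpr_isExprInstr h a ha
  obtain hx | ⟨r, hx⟩ := hx <;> rw [hx] at this <;> exact this

theorem compileExpr_labels (h : Θ.compileExpr C A l e = some (P, r, C')) {x : ℕ}
    (hx : labels (P.map Prod.fst) x) : l = some x := by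
  induction e generalizing C A l P r C' with
  | const n =>
    obtain ⟨-, rfl, -⟩ := compileExpr_const h
    simpa [labels] using hx
  | var v =>
    obtain ⟨-, rfl, -⟩ | ⟨-, rfl, -⟩ := compileExpr_var h
    · exact absurd hx not_labels_nil
    · simpa [labels] using hx
  | bin o e₁ e₂ ih₁ ih₂ =>
    obtain ⟨P₁, C₁, P₂, r₂, C₂, h₁, h₂, rfl, -⟩ := compileExpr_bin h
    simp only [List.map_append, labels_append, List.map_cons, List.map_nil, labels_cons,
      not_labels_nil, or_false] at hx
    obtain hx | hx | hx := hx
    · exact ih₁ h₁ hx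
    · have := ih₂ h₂ hx
      split at this
      · exact this
      · cases this
    · split at hx
      · exact hx
      · cases hx

theorem compileExpr_head (h : Θ.compileExpr C A l e = some (P, r, C')) :
    ∀ i ∈ P.head?, i.1.1 = l := by
  induction e generalizing C A l P r C' with
  | const n => obtain ⟨-, rfl, -⟩ := compileExpr_const h; simp
  | var v => obtain ⟨-, rfl, -⟩ | ⟨-, rfl, -⟩ := compileExpr_var h <;> simp
  | bin o e₁ e₂ ih₁ ih₂ =>
    obtain ⟨P₁, C₁, P₂, r₂, C₂, h₁, h₂, rfl, -⟩ := compileExpr_bin h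
    cases P₁ with
    | cons a P₁ => simpa using ih₁ h₁
    | nil =>
      cases P₂ with
      | cons a P₂ => simpa using ih₂ h₂
      | nil => simp

theorem compileExpr_annot_zero (h : Θ.compileExpr C A l e = some (P, r, C')) :
    annot P C' 0 = some C := by
  induction e generalizing C A l P r C' with
  | const n => obtain ⟨-, rfl, -⟩ := compileExpr_const h; simp
  | var v => obtain ⟨-, rfl, rfl⟩ | ⟨-, rfl, -⟩ := compileExpr_var h <;> simp
  | bin o e₁ e₂ ih₁ ih₂ =>
    obtain ⟨P₁, C₁, P₂, r₂, C₂, h₁, h₂, rfl, -⟩ := compileExpr_bin h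
    rw [annot_append_left (D := C₁) _ (Nat.zero_le _), ih₁ h₁]
    rw [annot_append_left (D := C₂) annot_cons_zero (Nat.zero_le _), ih₂ h₂]

/-- Only a cached variable compiles to no code, and a cache hit needs an entry in the record. Loops
flush the record and so always evaluate their condition by at least one instruction. -/
theorem compileExpr_ne_nil (h : Θ.compileExpr C A l e = some (P, r, C'))
    (hC : ∀ r, C.regrec r = none) : P ≠ [] := by
  cases e with
  | const n => obtain ⟨-, rfl, -⟩ := compileExpr_const h; simp
  | var v =>
    obtain ⟨h, -⟩ | ⟨-, rfl, -⟩ := compileExpr_var h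
    · have := Θ.regAllocCached_eq _ _ _ _ h
      rw [hC] at this
      cases this
    · simp
  | bin o e₁ e₂ =>
    obtain ⟨P₁, C₁, P₂, r₂, C₂, h₁, h₂, rfl, -⟩ := compileExpr_bin h
    simp

/-- Executing an instruction of a compiled expression preserves the validity of the
annotations. -/
theorem compileExpr_exec (h : Θ.compileExpr C A l e = some (P, r, C'))
    (he : Θ.exprStable C.asmrec e) {pc : ℕ} {lo : Option ℕ} {i : Instr Val Var Lock Op Reg}
    {D : CompRec Val Var Lock Op Reg} (hi : P[pc]? = some ((lo, i), D))
    {T : List (LInstr Val Var Lock Op Reg)} {n n' regs regs' mds mds' mem mem'}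
    (hD : Θ.configConsistent D regs mds mem) (hDs : Θ.regrecStable D)
    (hx : Θ.Exec T i n regs mds mem n' regs' mds' mem') :
    n' = n + 1 ∧ mds' = mds ∧ mem' = mem ∧ Θ.okAt P C' (pc + 1) regs' mds mem := by
  induction e generalizing C A l P r C' pc with
  | const k =>
    obtain ⟨-, rfl, rfl⟩ := compileExpr_const h
    obtain rfl : pc = 0 := by
      by_contra hn
      rw [List.getElem?_eq_none (by simp; omega)] at hi
      cases hi
    cases hi
    cases hx
    exact ⟨rfl, rfl, rfl, _, rfl, hD.upd _ _ rfl, hDs.upd _ he⟩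
  | var v =>
    obtain ⟨-, rfl, rfl⟩ | ⟨-, rfl, rfl⟩ := compileExpr_var h
    · simp at hi
    obtain rfl : pc = 0 := by
      by_contra hn
      rw [List.getElem?_eq_none (by simp; omega)] at hi
      cases hi
    cases hi
    cases hx
    exact ⟨rfl, rfl, rfl, _, rfl, hD.upd _ _ rfl, hDs.upd _ he⟩
  | bin o e₁ e₂ ih₁ ih₂ =>
    obtain ⟨P₁, C₁, P₂, r₂, C₂, h₁, h₂, rfl, rfl⟩ := compileExpr_bin h
    have ha₁ := compileExpr_asmrec h₁
    have ha₂ := compileExpr_asmrec h₂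
    have h0 := compileExpr_annot_zero h₂
    by_cases hpc : pc < P₁.length
    · rw [List.getElem?_append_left hpc] at hi
      obtain ⟨hn, hm, hm', hok⟩ := ih₁ h₁ (fun v hv => he v (.inl hv)) hi
      refine ⟨hn, hm, hm', (okAt_append_left (D := C₁) ?_ hpc).2 hok⟩
      rw [annot_append_left (D := C₂) annot_cons_zero (Nat.zero_le _), h0]
    obtain ⟨q, rfl⟩ := Nat.exists_eq_add_of_le (not_lt.1 hpc)
    rw [List.getElem?_append_right (by omega), Nat.add_sub_cancel_left] at hi
    rw [add_assoc, okAt_append_right]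
    by_cases hq : q < P₂.length
    · rw [List.getElem?_append_left hq] at hi
      obtain ⟨hn, hm, hm', hok⟩ := ih₂ h₂ (by rw [ha₁]; exact fun v hv => he v (.inr hv)) hi
      exact ⟨hn, hm, hm', (okAt_append_left annot_cons_zero hq).2 hok⟩
    obtain ⟨s, rfl⟩ := Nat.exists_eq_add_of_le (not_lt.1 hq)
    rw [List.getElem?_append_right (by omega), Nat.add_sub_cancel_left] at hi
    rw [add_assoc, okAt_append_right]
    obtain rfl : s = 0 := by
      by_contra hn
      rw [List.getElem?_eq_none (by simp; omega)] at hi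
      cases hi
    cases hi
    cases hx
    refine ⟨rfl, rfl, rfl, _, rfl, hD.upd _ _ ?_, hDs.upd _ ?_⟩
    -- Both operands are recorded in the annotation of the `op` instruction: the right one because
    -- it was just computed, the left one because its register was in use meanwhile.
    · rw [hD.1 _ _ (compileExpr_regrec h₂), hD.1 r e₁]
      · rfl
      · rw [compileExpr_regrec_of_mem h₂ (.inr rfl), compileExpr_regrec h₁]
    · rw [ha₂, ha₁]; exact he

/-- Steps within the code of an expression that is followed by an instruction annotated with the
final record of the expression. -/
theorem compileExpr_step (h : Θ.compileExpr C A l e = some (P, r, C'))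
    (he : Θ.exprStable C.asmrec e) {pc : ℕ} (hpc : pc < P.length)
    {i : LInstr Val Var Lock Op Reg}
    {R : List (LInstr Val Var Lock Op Reg × CompRec Val Var Lock Op Reg)} {regs mds mem lcr'}
    (hg : Θ.guardsAt (P ++ (i, C') :: R) pc regs mds mem)
    (hs : Θ.RStep ⟨⟨pc, (P ++ (i, C') :: R).map Prod.fst, regs⟩, mds, mem⟩ lcr') :
    (∃ regs', lcr' = ⟨⟨pc + 1, (P ++ (i, C') :: R).map Prod.fst, regs'⟩, mds, mem⟩ ∧
      Θ.guardsAt (P ++ (i, C') :: R) (pc + 1) regs' mds mem) ∧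
    ∃ lo j, ((P ++ (i, C') :: R).map Prod.fst)[pc]? = some (lo, j) ∧ isExprInstr j := by
  obtain ⟨⟨lo, j⟩, D, hi, hD, hDs⟩ := hg
  have hi' : ((P ++ (i, C') :: R).map Prod.fst)[pc]? = some (lo, j) := by
    rw [List.getElem?_map, hi]; rfl
  rw [List.getElem?_append_left hpc] at hi
  refine ⟨?_, lo, j, hi', compileExpr_isExprInstr h _ (List.mem_of_getElem? hi)⟩
  obtain ⟨pc', regs', mds', mem', rfl, hx⟩ := hs.exec hi'
  obtain ⟨rfl, rfl, rfl, hok⟩ := compileExpr_exec h he hi hD hDs hx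
  exact ⟨regs', rfl, ((okAt_append_left (C := C') annot_cons_zero hpc).2 hok).guardsAt
    (by simp; omega)⟩

end expr

end Params

theorem labels_of_head {P : List (LInstr Val Var Lock Op Reg)} {l : ℕ}
    (h : ∃ i, P.head? = some (some l, i)) : labels P l := by
  obtain ⟨i, hi⟩ := h
  exact ⟨_, List.mem_of_mem_head? hi, rfl⟩

namespace Params

variable {Θ : Params Val Var Lock Op Reg}

/-! ### Compilation of commands -/

section inversion

variable {C : CompRec Val Var Lock Op Reg} {l : Option ℕ} {nl : ℕ}
  {P : List (LInstr Val Var Lock Op Reg × CompRec Val Var Lock Op Reg)} {l' : Option ℕ} {nl' : ℕ}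
  {C' : CompRec Val Var Lock Op Reg}

theorem compileCmd_ne_halt {c : Cmd Val Var Lock Op}
    (h : Θ.compileCmd C l nl c = some (P, l', nl', C')) : c ≠ .halt := by
  rintro rfl
  cases h

open Classical in
theorem compileCmd_assign {v : Var} {e : Expr Val Var Op}
    (h : Θ.compileCmd C l nl (.assign v e) = some (P, l', nl', C')) :
    ∃ Pe r C₁, Θ.compileExpr C ∅ l e = some (Pe, r, C₁) ∧ Θ.writeSafe C₁.asmrec v ∧
      P = Pe ++ [((if Pe = [] then l else none, .store v r), C₁)] ∧ l' = none ∧ nl' = nl ∧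
      C' = ⟨keep (fun e' => v ∉ e'.vars) C₁.regrec, C₁.asmrec⟩ := by
  rw [compileCmd] at h
  split at h
  · cases h
  · split at h
    · cases h
      exact ⟨_, _, _, by assumption, by assumption, rfl, rfl, rfl, rfl⟩
    · cases h

theorem compileCmd_seq {c₁ c₂ : Cmd Val Var Lock Op}
    (h : Θ.compileCmd C l nl (.seq c₁ c₂) = some (P, l', nl', C')) :
    ∃ P₁ l₁ nl₁ C₁ P₂, Θ.compileCmd C l nl c₁ = some (P₁, l₁, nl₁, C₁) ∧
      Θ.compileCmd C₁ l₁ nl₁ c₂ = some (P₂, l', nl', C') ∧ P = P₁ ++ P₂ := by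
  rw [compileCmd] at h
  split at h
  · cases h
  · split at h
    · cases h
    · rename_i h₁ _ _ _ _ _ h₂
      cases h
      exact ⟨_, _, _, _, _, h₁, h₂, rfl⟩

open Classical in
theorem compileCmd_ite {e : Expr Val Var Op} {c₁ c₂ : Cmd Val Var Lock Op}
    (h : Θ.compileCmd C l nl (.ite e c₁ c₂) = some (P, l', nl', C')) :
    ∃ Pe r C₁ P₁ l₁ nl₁ C₂ P₂ l₂ C₃, Θ.compileExpr C ∅ l e = some (Pe, r, C₁) ∧
      Θ.compileCmd C₁ none (nl + 2) c₁ = some (P₁, l₁, nl₁, C₂) ∧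
      Θ.compileCmd C₁ (some nl) nl₁ c₂ = some (P₂, l₂, nl', C₃) ∧
      P = Pe ++ ((if Pe = [] then l else none, .jz nl r), C₁) ::
        (P₁ ++ ((l₁, .jmp (nl + 1)), C₂) :: (P₂ ++ [((l₂, .nopEpi), C₃)])) ∧
      l' = some (nl + 1) ∧ C' = ⟨meet C₂.regrec C₃.regrec, C₂.asmrec⟩ := by
  rw [compileCmd] at h
  split at h
  · cases h
  · dsimp only at h
    split at h
    · cases h
    · split at h
      · cases h
      · rename_i he _ _ _ _ _ h₁ _ _ _ _ _ h₂
        cases h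
        exact ⟨_, _, _, _, _, _, _, _, _, _, he, h₁, h₂, by simp, rfl, rfl⟩

theorem compileCmd_while {e : Expr Val Var Op} {c : Cmd Val Var Lock Op}
    (h : Θ.compileCmd C l nl (.while e c) = some (P, l', nl', C')) :
    ∃ Pe r Pc lc C₂,
      Θ.compileExpr ⟨fun _ => none, C.asmrec⟩ ∅ (some (l.getD nl)) e = some (Pe, r, C') ∧
      Θ.compileCmd C' none (nl + 2) c = some (Pc, lc, nl', C₂) ∧
      P = Pe ++ ((none, .jz (nl + 1) r), C') :: (Pc ++ [((lc, .jmp (l.getD nl)), C₂)]) ∧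
      l' = some (nl + 1) := by
  rw [compileCmd] at h
  split at h
  · cases h
  · split at h
    · cases h
    · rename_i he _ _ _ _ _ h₁
      cases h
      exact ⟨_, _, _, _, _, he, h₁, by simp, rfl⟩

end inversion

/-! ### Records, first annotations and labels of compiled commands. -/

section spec

variable {c : Cmd Val Var Lock Op} {C : CompRec Val Var Lock Op Reg} {l : Option ℕ} {nl : ℕ}
  {P : List (LInstr Val Var Lock Op Reg × CompRec Val Var Lock Op Reg)} {l' : Option ℕ} {nl' : ℕ}
  {C' : CompRec Val Var Lock Op Reg}

/-- The assumption part of the compiler's record evolves as the static check predicts. The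
conditions of `stableFrom` on branches and loop bodies thereby become equations between records. -/
theorem compileCmd_asmrec (h : Θ.compileCmd C l nl c = some (P, l', nl', C')) :
    C'.asmrec = Θ.asmAfter c C.asmrec := by
  induction c generalizing C l nl P l' nl' C' with
  | halt => cases h
  | skip => cases h; rfl
  | seq c₁ c₂ ih₁ ih₂ =>
    obtain ⟨P₁, l₁, nl₁, C₁, P₂, h₁, h₂, -⟩ := compileCmd_seq h
    rw [ih₂ h₂, ih₁ h₁]; rfl
  | ite e c₁ c₂ ih₁ ih₂ =>
    obtain ⟨Pe, r, C₁, P₁, l₁, nl₁, C₂, P₂, l₂, C₃, he, h₁, h₂, -, -, rfl⟩ := compileCmd_ite h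
    exact (ih₁ h₁).trans (by rw [compileExpr_asmrec he]; rfl)
  | assign v e =>
    obtain ⟨Pe, r, C₁, he, -, -, -, -, rfl⟩ := compileCmd_assign h
    have := compileExpr_asmrec he
    exact this
  | lockAcq k => cases h; rfl
  | lockRel k => cases h; rfl
  -- The remaining case is the loop. Its final record is the one just after the condition, so the
  -- body plays no part.
  | _ =>
    rename_i e c ih
    obtain ⟨Pe, r, Pc, lc, C₂, he, -⟩ := compileCmd_while h
    have := compileExpr_asmrec he
    exact this

theorem regrecStable_empty (S : AsmRec Var Lock) :
    Θ.regrecStable (⟨fun _ => none, S⟩ : CompRec Val Var Lock Op Reg) := by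
  intro r e h
  cases h

theorem exprStable.mono {S S' : AsmRec Var Lock} {e : Expr Val Var Op}
    (h : Θ.exprStable S e) (hS : S.1 ∪ S.2 ⊆ S'.1 ∪ S'.2) : Θ.exprStable S' e :=
  fun v hv => ⟨hS (h v hv).1, fun y hy => hS ((h v hv).2 y hy)⟩

theorem exprStable.acqAsm {S : AsmRec Var Lock} {e : Expr Val Var Op}
    (h : Θ.exprStable S e) (k : Lock) : Θ.exprStable (Θ.acqAsm k S) e :=
  h.mono (Set.union_subset_union Set.subset_union_left Set.subset_union_left)

theorem regrecStable.keep (h : Θ.regrecStable C) (p : Expr Val Var Op → Prop) :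
    Θ.regrecStable ⟨keep p C.regrec, C.asmrec⟩ :=
  fun r e he => h r e (keep_eq_some.1 he).1

/-- Acquiring a lock only enlarges the assumptions; releasing one shrinks them, but the compiler
then discards the entries that cease to be stable. The other commands record only expressions that
the static check found stable. -/
theorem compileCmd_regrecStable (h : Θ.compileCmd C l nl c = some (P, l', nl', C'))
    (hc : Θ.stableFrom c C.asmrec) (hC : Θ.regrecStable C) : Θ.regrecStable C' := by
  induction c generalizing C l nl P l' nl' C' with
  | halt => cases h
  | skip => cases h; exact hC
  | seq c₁ c₂ ih₁ ih₂ =>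
    obtain ⟨P₁, l₁, nl₁, C₁, P₂, h₁, h₂, -⟩ := compileCmd_seq h
    exact ih₂ h₂ (by rw [compileCmd_asmrec h₁]; exact hc.2) (ih₁ h₁ hc.1 hC)
  | ite e c₁ c₂ ih₁ ih₂ =>
    obtain ⟨Pe, r, C₁, P₁, l₁, nl₁, C₂, P₂, l₂, C₃, he, h₁, h₂, -, -, rfl⟩ := compileCmd_ite h
    have := ih₁ h₁ (by rw [compileExpr_asmrec he]; exact hc.2.1)
      (compileExpr_regrecStable he hc.1 hC)
    exact fun r e hre => this r e (meet_eq_some.1 hre).1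
  | assign v e =>
    obtain ⟨Pe, r, C₁, he, -, -, -, -, rfl⟩ := compileCmd_assign h
    exact (compileExpr_regrecStable he hc hC).keep _
  | lockAcq k => cases h; exact fun r e he => (hC r e he).acqAsm k
  | lockRel k => cases h; exact fun r e he => (keep_eq_some.1 he).2
  | _ =>
    rename_i e c ih
    obtain ⟨Pe, r, Pc, lc, C₂, he, -⟩ := compileCmd_while h
    exact compileExpr_regrecStable he hc.1 (regrecStable_empty _)

/-- The annotation of the first instruction is the initial record, except that a loop flushes the
register record. -/
theorem compileCmd_getElem?_zero (h : Θ.compileCmd C l nl c = some (P, l', nl', C')) :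
    ∃ i D, P[0]? = some (i, D) ∧ (D = C ∨ D = ⟨fun _ => none, C.asmrec⟩) := by
  have aux : ∀ {D D' A l e Pe r R} {i : LInstr Val Var Lock Op Reg},
      Θ.compileExpr D A l e = some (Pe, r, D') →
        ∃ j, (Pe ++ (i, D') :: R)[0]? = some (j, D) := fun he => by
    -- The final record is a dummy here: the code is nonempty, so position `0` carries a genuine
    -- annotation.
    refine getElem?_of_annot (C := C') ?_ (by simp)
    rw [annot_append_left annot_cons_zero (Nat.zero_le _), compileExpr_annot_zero he]
  induction c generalizing C l nl P l' nl' C' with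
  | halt => cases h
  | skip => cases h; exact ⟨_, _, rfl, .inl rfl⟩
  | seq c₁ c₂ ih₁ ih₂ =>
    obtain ⟨P₁, l₁, nl₁, C₁, P₂, h₁, h₂, rfl⟩ := compileCmd_seq h
    obtain ⟨i, D, hi, hD⟩ := ih₁ h₁
    refine ⟨i, D, ?_, hD⟩
    cases P₁ with
    | nil => cases hi
    | cons a P₁ => exact hi
  | ite e c₁ c₂ ih₁ ih₂ =>
    obtain ⟨Pe, r, C₁, P₁, l₁, nl₁, C₂, P₂, l₂, C₃, he, h₁, h₂, rfl, -⟩ := compileCmd_ite h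
    obtain ⟨j, hj⟩ := aux he
    exact ⟨j, _, hj, .inl rfl⟩
  | assign v e =>
    obtain ⟨Pe, r, C₁, he, -, rfl, -⟩ := compileCmd_assign h
    obtain ⟨j, hj⟩ := aux he
    exact ⟨j, _, hj, .inl rfl⟩
  | lockAcq k => cases h; exact ⟨_, _, rfl, .inl rfl⟩
  | lockRel k => cases h; exact ⟨_, _, rfl, .inl rfl⟩
  | _ =>
    rename_i e c ih
    obtain ⟨Pe, r, Pc, lc, C₂, he, -, rfl, -⟩ := compileCmd_while h
    obtain ⟨j, hj⟩ := aux he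
    exact ⟨j, _, hj, .inr rfl⟩

/-- A flushed register record claims nothing about the registers, so replacing the initial record by
it loses neither consistency nor stability. -/
theorem compileCmd_guardsAt_zero (h : Θ.compileCmd C l nl c = some (P, l', nl', C'))
    {regs mds mem} (hC : Θ.configConsistent C regs mds mem) (hs : Θ.regrecStable C) :
    Θ.guardsAt P 0 regs mds mem := by
  obtain ⟨i, D, hi, rfl | rfl⟩ := compileCmd_getElem?_zero h
  · exact ⟨i, _, hi, hC, hs⟩
  · exact ⟨i, _, hi, ⟨fun r e he => (Option.some_ne_none e he.symm).elim, hC.2⟩,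
      regrecStable_empty _⟩

theorem compileCmd_length_pos (h : Θ.compileCmd C l nl c = some (P, l', nl', C')) :
    0 < P.length := by
  obtain ⟨i, D, hi, -⟩ := compileCmd_getElem?_zero h
  exact (List.getElem?_eq_some_iff.1 hi).1

/-- The use of labels in code with entry label `l` and exit label `l'`, whose other labels are
drawn from `[nl, nl')`. -/
structure LabelSpec (T : List (LInstr Val Var Lock Op Reg)) (l : Option ℕ) (nl : ℕ)
    (l' : Option ℕ) (nl' : ℕ) : Prop where
  le : nl ≤ nl'
  exit : ∀ x, l' = some x → nl ≤ x ∧ x < nl'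
  labels : ∀ x, labels T x → l = some x ∨ nl ≤ x ∧ x < nl'
  not_labels_exit : ∀ x, l' = some x → ¬ WRCompiler.labels T x
  jumps : ∀ x, jumpsTo T x → WRCompiler.labels T x ∨ l' = some x
  head : ∀ x, l = some x → ∃ i, T.head? = some (some x, i)

theorem head?_expr_append {A : Set Reg} {e : Expr Val Var Op} {Pe r C₁} {x : ℕ}
    (he : Θ.compileExpr C A (some x) e = some (Pe, r, C₁)) {lo : Option ℕ}
    (hlo : Pe = [] → lo = some x) {i : Instr Val Var Lock Op Reg} {D : CompRec Val Var Lock Op Reg}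
    {R : List (LInstr Val Var Lock Op Reg × CompRec Val Var Lock Op Reg)} :
    ∃ j, ((Pe ++ ((lo, i), D) :: R).map Prod.fst).head? = some (some x, j) := by
  have := compileExpr_head he
  cases Pe with
  | nil => exact ⟨i, by simp [hlo rfl]⟩
  | cons a Pe => exact ⟨a.1.2, by simp [← this a rfl]⟩

/-- Freshness of the counter: a conditional or loop reserves `nl` and `nl + 1` and compiles its
parts from `nl + 2` on, while the entry label lies below `nl`. The reserved exit label is attached
to no instruction inside; it is left for the code that follows. -/
theorem compileCmd_labelSpec (h : Θ.compileCmd C l nl c = some (P, l', nl', C'))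
    (hl : ∀ x, l = some x → x < nl) : LabelSpec (P.map Prod.fst) l nl l' nl' := by
  induction c generalizing C l nl P l' nl' C' with
  | halt => cases h
  | skip => cases h; constructor <;> simp +contextual [labels_cons, jumpsTo_cons]
  | lockAcq k => cases h; constructor <;> simp +contextual [labels_cons, jumpsTo_cons]
  | lockRel k => cases h; constructor <;> simp +contextual [labels_cons, jumpsTo_cons]
  | assign v e =>
    obtain ⟨Pe, r, C₁, he, -, rfl, rfl, rfl, -⟩ := compileCmd_assign h
    have hj := compileExpr_not_jumpsTo he
    refine ⟨le_rfl, by simp, fun x hx => ?_, by simp, fun x hx => ?_, ?_⟩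
    · simp only [List.map_append, labels_append, List.map_cons, List.map_nil, labels_cons,
        not_labels_nil, or_false] at hx
      obtain hx | hx := hx
      · exact .inl (compileExpr_labels he hx)
      · split at hx
        · exact .inl hx
        · cases hx
    · simp [jumpsTo_append, jumpsTo_cons, hj] at hx
    · rintro x rfl
      exact head?_expr_append he fun h => by simp [h]
  | seq c₁ c₂ ih₁ ih₂ =>
    obtain ⟨P₁, l₁, nl₁, C₁, P₂, h₁, h₂, rfl⟩ := compileCmd_seq h
    have s₁ := ih₁ h₁ hl
    have s₂ := ih₂ h₂ fun x hx => (s₁.exit x hx).2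
    have := s₁.le
    have := s₂.le
    simp only [List.map_append]
    refine ⟨by omega, fun x hx => ?_, fun x hx => ?_, fun x hx => ?_, fun x hx => ?_,
      fun x hx => ?_⟩
    · have := s₂.exit x hx
      omega
    · obtain hx | hx := labels_append.1 hx
      · exact (s₁.labels x hx).imp_right fun _ => by omega
      · obtain hx | hx := s₂.labels x hx
        · have := s₁.exit x hx
          exact .inr (by omega)
        · exact .inr (by omega)
    · have := s₂.exit x hx
      rw [labels_append]
      rintro (hx' | hx')
      · obtain h' | h' := s₁.labels x hx'
        · have := hl x h'
          omega
        · omega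
      · exact s₂.not_labels_exit x hx hx'
    · rw [labels_append]
      obtain hx | hx := jumpsTo_append.1 hx
      · obtain hx | hx := s₁.jumps x hx
        · exact .inl (.inl hx)
        · exact .inl (.inr (labels_of_head (s₂.head x hx)))
      · exact (s₂.jumps x hx).imp_left .inr
    · obtain ⟨i, hi⟩ := s₁.head x hx
      exact ⟨i, by rw [List.head?_append, hi]; rfl⟩
  | ite e c₁ c₂ ih₁ ih₂ =>
    obtain ⟨Pe, r, C₁, P₁, l₁, nl₁, C₂, P₂, l₂, C₃, he, h₁, h₂, rfl, rfl, -⟩ := compileCmd_ite h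
    have s₁ := ih₁ h₁ (by simp)
    have le₁ := s₁.le
    have s₂ := ih₂ h₂ fun x hx => by cases hx; omega
    have le₂ := s₂.le
    have hj := compileExpr_not_jumpsTo he
    -- The value `nl + 1` is absent from this list, which is why the exit label occurs nowhere in
    -- the code.
    have hlab : ∀ x, WRCompiler.labels (List.map Prod.fst
        (Pe ++ ((if Pe = [] then l else none, .jz nl r), C₁) ::
          (P₁ ++ ((l₁, .jmp (nl + 1)), C₂) :: (P₂ ++ [((l₂, .nopEpi), C₃)])))) x →
        l = some x ∨ x = nl ∨ nl + 2 ≤ x ∧ x < nl' := by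
      intro x hx
      simp only [List.map_append, labels_append, List.map_cons, List.map_nil, labels_cons,
        not_labels_nil, or_false] at hx
      obtain hx | hx | hx | hx | hx | hx := hx
      · exact .inl (compileExpr_labels he hx)
      · split at hx
        · exact .inl hx
        · cases hx
      · obtain hx | hx := s₁.labels x hx
        · cases hx
        · omega
      · have := s₁.exit x hx
        omega
      · obtain hx | hx := s₂.labels x hx
        · cases hx; omega
        · omega
      · have := s₂.exit x hx
        omega
    refine ⟨by omega, fun x hx => by cases hx; omega, fun x hx => ?_, fun x hx hx' => ?_,
      fun x hx => ?_, ?_⟩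
    · exact (hlab x hx).imp_right fun _ => by omega
    · cases hx
      obtain h | h := hlab _ hx'
      · have := hl _ h
        omega
      · omega
    · simp only [List.map_append, jumpsTo_append, List.map_cons, List.map_nil, jumpsTo_cons,
        not_jumpsTo_nil, hj, Instr.jz.injEq, Instr.jmp.injEq, reduceCtorEq, false_or, or_false,
        exists_false, exists_eq_right'] at hx
      simp only [List.map_append, labels_append, List.map_cons, List.map_nil, labels_cons,
        not_labels_nil, or_false]
      -- Jump targets: `nl` heads the second branch, a jump leaving the first branch finds `l₁` on
      -- the `jmp`, `nl + 1` is the exit label, and a jump leaving the second branch finds `l₂` on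
      -- the `nopEpi`.
      obtain rfl | hx | rfl | hx := hx
      · have := labels_of_head (s₂.head _ rfl)
        tauto
      · obtain hx | hx := s₁.jumps x hx <;> tauto
      · exact .inr rfl
      · obtain hx | hx := s₂.jumps x hx <;> tauto
    · rintro x rfl
      exact head?_expr_append he fun h => by simp [h]
  | _ =>
    rename_i e c ih
    obtain ⟨Pe, r, Pc, lc, C₂, he, h₁, rfl, rfl⟩ := compileCmd_while h
    have s₁ := ih h₁ (by simp)
    have le₁ := s₁.le
    have hj := compileExpr_not_jumpsTo he
    -- The flushed record forces code for the condition, so the entry label is on its first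
    -- instruction and the unlabelled `jz` is never first.
    have hne := compileExpr_ne_nil he fun _ => rfl
    have hlp : l = some (l.getD nl) ∨ l.getD nl = nl := by cases l <;> simp
    have hlab : ∀ x, WRCompiler.labels (List.map Prod.fst
        (Pe ++ ((none, .jz (nl + 1) r), C') :: (Pc ++ [((lc, .jmp (l.getD nl)), C₂)]))) x →
        l = some x ∨ x = nl ∨ nl + 2 ≤ x ∧ x < nl' := by
      intro x hx
      simp only [List.map_append, labels_append, List.map_cons, List.map_nil, labels_cons,
        not_labels_nil, or_false, reduceCtorEq, false_or] at hx
      obtain hx | hx | hx := hx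
      · cases compileExpr_labels he hx
        exact hlp.imp_right .inl
      · obtain hx | hx := s₁.labels x hx
        · cases hx
        · omega
      · have := s₁.exit x hx
        omega
    have hhd := head?_expr_append he (lo := none) (i := .jz (nl + 1) r) (D := C')
      (R := Pc ++ [((lc, .jmp (l.getD nl)), C₂)]) fun h => absurd h hne
    refine ⟨by omega, fun x hx => by cases hx; omega, fun x hx => ?_, fun x hx hx' => ?_,
      fun x hx => ?_, ?_⟩
    · exact (hlab x hx).imp_right fun _ => by omega
    · cases hx
      obtain h | h := hlab _ hx'
      · have := hl _ h
        omega
      · omega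
    · have := labels_of_head hhd
      simp only [List.map_append, jumpsTo_append, List.map_cons, List.map_nil, jumpsTo_cons,
        not_jumpsTo_nil, hj, Instr.jz.injEq, Instr.jmp.injEq, reduceCtorEq, false_or, or_false,
        exists_false, exists_eq_right'] at hx
      simp only [List.map_append, labels_append, List.map_cons, List.map_nil, labels_cons,
        not_labels_nil, or_false] at this ⊢
      obtain rfl | hx | rfl := hx
      · exact .inr rfl
      · obtain hx | hx := s₁.jumps x hx <;> tauto
      · exact .inl this
    · rintro x rfl
      exact hhd

end spec

end Params

namespace Params

variable {Θ : Params Val Var Lock Op Reg}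

/-! ### Code of a sequence -/

/-- A jump that leaves `P` aims at its exit label, which is the entry label of `Q`. -/
theorem LabelSpec.joinableForward {P Q : List (LInstr Val Var Lock Op Reg)}
    {l l₁ l₂ : Option ℕ} {nl nl₁ nl₂ : ℕ} (s₁ : LabelSpec P l nl l₁ nl₁)
    (s₂ : LabelSpec Q l₁ nl₁ l₂ nl₂) : joinableForward P Q :=
  fun x hx => (s₁.jumps x hx).imp_right (s₂.head x)

/-- The targets of jumps, like the labels of instructions, are drawn from the same stock. -/
theorem LabelSpec.jumps_range {P : List (LInstr Val Var Lock Op Reg)}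
    {l l' : Option ℕ} {nl nl' : ℕ} (s : LabelSpec P l nl l' nl') {x : ℕ} (hx : jumpsTo P x) :
    l = some x ∨ nl ≤ x ∧ x < nl' :=
  (s.jumps x hx).elim (s.labels x) fun h => .inr (s.exit x h)

/-- Jumps of `Q` aim at `l₁` or at labels from `nl₁` on. Labels of `P` lie below `nl₁`, and `l₁` is
not among them. -/
theorem LabelSpec.joinableBackward {P Q : List (LInstr Val Var Lock Op Reg)}
    {l l₁ l₂ : Option ℕ} {nl nl₁ nl₂ : ℕ} (s₁ : LabelSpec P l nl l₁ nl₁)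
    (s₂ : LabelSpec Q l₁ nl₁ l₂ nl₂) (hl : ∀ x, l = some x → x < nl) : joinableBackward P Q := by
  intro x hx hP
  obtain h | h := s₂.jumps_range hx
  · exact s₁.not_labels_exit x h hP
  · have := s₁.le
    obtain h' | h' := s₁.labels x hP
    · have := hl x h'
      omega
    · omega

theorem RStep.lt_length {P : List (LInstr Val Var Lock Op Reg)} {pc regs mds mem lcr'}
    (h : Θ.RStep ⟨⟨pc, P, regs⟩, mds, mem⟩ lcr') : pc < P.length := by
  cases h with
  | mk P lo i pc regs mds mem pc' regs' mds' mem' hi hx =>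
    exact (List.getElem?_eq_some_iff.1 hi).1

theorem RStep.of_append_left {P Q : List (LInstr Val Var Lock Op Reg)} {pc regs mds mem lcr'}
    (hj : WRCompiler.joinableForward P Q) (hpc : pc < P.length)
    (h : Θ.RStep ⟨⟨pc, P ++ Q, regs⟩, mds, mem⟩ lcr') :
    ∃ pc' regs' mds' mem', lcr' = ⟨⟨pc', P ++ Q, regs'⟩, mds', mem'⟩ ∧
      Θ.RStep ⟨⟨pc, P, regs⟩, mds, mem⟩ ⟨⟨pc', P, regs'⟩, mds', mem'⟩ := by
  rw [← List.nil_append (P ++ Q), ← Nat.zero_add pc] at h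
  simpa using RStep.of_context (A := []) (by simp)
    (fun _ => resolve_append_of_joinableForward hj) hpc h

theorem RStep.of_append_right {P Q : List (LInstr Val Var Lock Op Reg)} {pc regs mds mem lcr'}
    (hj : WRCompiler.joinableBackward P Q)
    (h : Θ.RStep ⟨⟨P.length + pc, P ++ Q, regs⟩, mds, mem⟩ lcr') :
    ∃ pc' regs' mds' mem', lcr' = ⟨⟨P.length + pc', P ++ Q, regs'⟩, mds', mem'⟩ ∧
      Θ.RStep ⟨⟨pc, Q, regs⟩, mds, mem⟩ ⟨⟨pc', Q, regs'⟩, mds', mem'⟩ := by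
  have := h.lt_length
  rw [List.length_append] at this
  rw [← List.append_nil Q] at h
  simpa using RStep.of_context (B := []) hj (by simp) (by omega) h

/-- At the end of `P` the next annotation need not be the final record of `P`, since `Q` may begin
with a loop that flushes it. Validity of the final record still suffices, by
`compileCmd_guardsAt_zero`. -/
theorem okAt.guardsAt_append {P Q : List (LInstr Val Var Lock Op Reg × CompRec Val Var Lock Op Reg)}
    {C C' : CompRec Val Var Lock Op Reg} {pc regs mds mem l nl c l' nl'}
    (h : Θ.okAt P C pc regs mds mem) (hQ : Θ.compileCmd C l nl c = some (Q, l', nl', C')) :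
    Θ.guardsAt (P ++ Q) pc regs mds mem := by
  have hpos := compileCmd_length_pos hQ
  obtain hpc | hpc := h.le_length.lt_or_eq
  · obtain ⟨i, D, hi, hD⟩ := h.guardsAt hpc
    exact ⟨i, D, by rwa [List.getElem?_append_left hpc], hD⟩
  · rw [hpc, okAt_length] at h
    have := (compileCmd_guardsAt_zero hQ h.1 h.2).okAt C'
    rw [hpc]
    exact (okAt_append_right.2 this).guardsAt (by simpa using hpos)

/-- `Q` occurs in `P` at position `n`, followed by an instruction annotated with `D`, and jumps
from `Q` stay in `Q` or lead to that instruction. -/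
def FragmentAt (P Q : List (LInstr Val Var Lock Op Reg × CompRec Val Var Lock Op Reg))
    (D : CompRec Val Var Lock Op Reg) (n : ℕ) : Prop :=
  ∃ A i B, P = A ++ (Q ++ (i, D) :: B) ∧ A.length = n ∧
    joinableBackward (A.map Prod.fst) (Q.map Prod.fst) ∧
    ∀ l, jumpsTo (Q.map Prod.fst) l → labels (Q.map Prod.fst) l ∨ i.1 = some l

/-! ### Passing between a fragment and the whole code. -/

section FragmentAt

variable {P Q : List (LInstr Val Var Lock Op Reg × CompRec Val Var Lock Op Reg)}
  {D : CompRec Val Var Lock Op Reg} {n q : ℕ}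

theorem FragmentAt.length_lt (h : FragmentAt P Q D n) : n + Q.length < P.length := by
  obtain ⟨A, i, B, rfl, rfl, -, -⟩ := h
  simp

theorem FragmentAt.okAt_iff (h : FragmentAt P Q D n) (hq : q ≤ Q.length)
    {C : CompRec Val Var Lock Op Reg} {regs mds mem} :
    Θ.okAt P C (n + q) regs mds mem ↔ Θ.okAt Q D q regs mds mem := by
  obtain ⟨A, i, B, rfl, rfl, -, -⟩ := h
  exact okAt_context hq

/-- Valid annotations of a fragment, including its end, yield guards in the whole code. -/
theorem FragmentAt.guardsAt (h : FragmentAt P Q D n) {regs mds mem}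
    (hok : Θ.okAt Q D q regs mds mem) : Θ.guardsAt P (n + q) regs mds mem := by
  have := h.length_lt
  have hq := hok.le_length
  exact ((h.okAt_iff (C := D) hq).2 hok).guardsAt (by omega)

theorem FragmentAt.guardsAt_iff (h : FragmentAt P Q D n) (hq : q < Q.length) {regs mds mem} :
    Θ.guardsAt P (n + q) regs mds mem ↔ Θ.guardsAt Q q regs mds mem :=
  ⟨fun hg => ((h.okAt_iff hq.le).1 (hg.okAt D)).guardsAt hq, fun hg => h.guardsAt (hg.okAt D)⟩

theorem FragmentAt.getElem?_eq (h : FragmentAt P Q D n) (hq : q < Q.length) :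
    (P.map Prod.fst)[n + q]? = (Q.map Prod.fst)[q]? := by
  obtain ⟨A, i, B, rfl, rfl, -, -⟩ := h
  rw [List.getElem?_map, getElem?_context hq, List.getElem?_map]

/-- Of the code after the fragment only the first instruction matters: a jump out of the fragment
lands there, at the position that is the end of the fragment taken alone. -/
theorem FragmentAt.step (h : FragmentAt P Q D n) (hq : q < Q.length) {regs mds mem lcr'}
    (hs : Θ.RStep ⟨⟨n + q, P.map Prod.fst, regs⟩, mds, mem⟩ lcr') :
    ∃ q' regs' mds' mem', lcr' = ⟨⟨n + q', P.map Prod.fst, regs'⟩, mds', mem'⟩ ∧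
      Θ.RStep ⟨⟨q, Q.map Prod.fst, regs⟩, mds, mem⟩
        ⟨⟨q', Q.map Prod.fst, regs'⟩, mds', mem'⟩ := by
  obtain ⟨A, i, B, rfl, rfl, hA, hB⟩ := h
  rw [List.map_append, List.map_append, ← List.length_map (f := Prod.fst) (as := A)] at hs ⊢
  refine hs.of_context hA (fun l hl => ?_) (by simpa using hq)
  refine resolve_append_of_joinableForward (fun l hl => (hB l hl).imp_right fun hl => ?_) hl
  exact ⟨i.2, by simp [← hl]⟩

end FragmentAt

theorem getElem?_map_fst {P : List (LInstr Val Var Lock Op Reg × CompRec Val Var Lock Op Reg)}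
    {pc : ℕ} {i D} (hi : P[pc]? = some (i, D)) : (P.map Prod.fst)[pc]? = some i := by
  rw [List.getElem?_map, hi]; rfl

open Classical in
/-- The evaluation of a condition and the branching on it. -/
noncomputable def condCode
    (Pe : List (LInstr Val Var Lock Op Reg × CompRec Val Var Lock Op Reg)) (l : Option ℕ)
    (br : ℕ) (r : Reg) (C : CompRec Val Var Lock Op Reg) :
    List (LInstr Val Var Lock Op Reg × CompRec Val Var Lock Op Reg) :=
  Pe ++ [((if Pe = [] then l else none, .jz br r), C)]

/-! ### Conditions: evaluation and branching. -/

section condCode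

variable {Pe R : List (LInstr Val Var Lock Op Reg × CompRec Val Var Lock Op Reg)} {l : Option ℕ}
    {br : ℕ} {r : Reg} {C C' : CompRec Val Var Lock Op Reg} {A : Set Reg} {e : Expr Val Var Op}

@[simp] theorem length_condCode : (condCode Pe l br r C).length = Pe.length + 1 := by
  simp [condCode]

open Classical in
theorem getElem?_condCode_append : (condCode Pe l br r C ++ R)[Pe.length]? =
    some ((if Pe = [] then l else none, .jz br r), C) := by
  simp [condCode]

theorem labels_condCode (h : Θ.compileExpr C A l e = some (Pe, r, C')) {x : ℕ}
    (hx : labels ((condCode Pe l br r C').map Prod.fst) x) : l = some x := by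
  simp only [condCode, List.map_append, labels_append, List.map_cons, List.map_nil, labels_cons,
    not_labels_nil, or_false] at hx
  obtain hx | hx := hx
  · exact compileExpr_labels h hx
  · split at hx
    · exact hx
    · cases hx

theorem condCode_step (h : Θ.compileExpr C A l e = some (Pe, r, C'))
    (he : Θ.exprStable C.asmrec e) {pc : ℕ} (hpc : pc < Pe.length) {regs mds mem lcr'}
    (hg : Θ.guardsAt (condCode Pe l br r C' ++ R) pc regs mds mem)
    (hs : Θ.RStep ⟨⟨pc, (condCode Pe l br r C' ++ R).map Prod.fst, regs⟩, mds, mem⟩ lcr') :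
    (∃ regs', lcr' = ⟨⟨pc + 1, (condCode Pe l br r C' ++ R).map Prod.fst, regs'⟩, mds, mem⟩ ∧
      Θ.guardsAt (condCode Pe l br r C' ++ R) (pc + 1) regs' mds mem) ∧
    ∃ lo j, ((condCode Pe l br r C' ++ R).map Prod.fst)[pc]? = some (lo, j) ∧ isExprInstr j := by
  rw [condCode, List.append_assoc, List.singleton_append] at *
  exact compileExpr_step h he hpc hg hs

/-- Branching on a condition. -/
theorem condCode_branch (h : Θ.compileExpr C A l e = some (Pe, r, C')) {regs mds mem lcr'}
    (hg : Θ.guardsAt (condCode Pe l br r C' ++ R) Pe.length regs mds mem)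
    (hs : Θ.RStep ⟨⟨Pe.length, (condCode Pe l br r C' ++ R).map Prod.fst, regs⟩, mds, mem⟩ lcr') :
    Θ.configConsistent C' regs mds mem ∧ Θ.regrecStable C' ∧
    (Θ.isTrue (e.ev Θ mem) ∧
      lcr' = ⟨⟨Pe.length + 1, (condCode Pe l br r C' ++ R).map Prod.fst, regs⟩, mds, mem⟩ ∨
     ¬ Θ.isTrue (e.ev Θ mem) ∧
      lcr' = ⟨⟨resolve ((condCode Pe l br r C' ++ R).map Prod.fst) br,
        (condCode Pe l br r C' ++ R).map Prod.fst, regs⟩, mds, mem⟩) := by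
  obtain ⟨i, D, hi, hD, hDs⟩ := hg
  rw [getElem?_condCode_append] at hi
  cases hi
  refine ⟨hD, hDs, ?_⟩
  -- The record at the `jz` contains the condition itself, so consistency makes the tested register
  -- agree with the condition that While evaluates.
  have hr : regs r = e.ev Θ mem := hD.1 _ _ (compileExpr_regrec h)
  obtain ⟨pc', regs', mds', mem', rfl, hx⟩ := hs.exec (getElem?_map_fst getElem?_condCode_append)
  cases hx with
  | jz_jump _ _ _ _ _ _ ht => exact .inr ⟨hr ▸ ht, rfl⟩
  | jz_next _ _ _ _ _ _ ht => exact .inl ⟨hr ▸ ht, rfl⟩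

theorem annot_condCode_append (h : Θ.compileExpr C A l e = some (Pe, r, C'))
    (D : CompRec Val Var Lock Op Reg) : annot (condCode Pe l br r C' ++ R) D 0 = some C := by
  rw [condCode, List.append_assoc, List.singleton_append,
    annot_append_left annot_cons_zero (Nat.zero_le _), compileExpr_annot_zero h]

end condCode

/-! ### Code of a conditional -/

/-- The parts of a compiled conditional. -/
structure IteCode (Θ : Params Val Var Lock Op Reg) (C : CompRec Val Var Lock Op Reg)
    (l : Option ℕ) (nl : ℕ) (e : Expr Val Var Op) (c₁ c₂ : Cmd Val Var Lock Op)
    (PCs Pe : List (LInstr Val Var Lock Op Reg × CompRec Val Var Lock Op Reg)) (r : Reg)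
    (C₁ : CompRec Val Var Lock Op Reg)
    (P₁ : List (LInstr Val Var Lock Op Reg × CompRec Val Var Lock Op Reg)) (l₁ : Option ℕ)
    (nl₁ : ℕ) (C₂ : CompRec Val Var Lock Op Reg)
    (P₂ : List (LInstr Val Var Lock Op Reg × CompRec Val Var Lock Op Reg)) (l₂ : Option ℕ)
    (nl₂ : ℕ) (C₃ : CompRec Val Var Lock Op Reg) : Prop where
  reqs : Θ.inputReqs C l nl (.ite e c₁ c₂)
  expr : Θ.compileExpr C ∅ l e = some (Pe, r, C₁)
  fst : Θ.compileCmd C₁ none (nl + 2) c₁ = some (P₁, l₁, nl₁, C₂)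
  snd : Θ.compileCmd C₁ (some nl) nl₁ c₂ = some (P₂, l₂, nl₂, C₃)
  code : PCs = condCode Pe l nl r C₁ ++
    (P₁ ++ ((l₁, .jmp (nl + 1)), C₂) :: (P₂ ++ [((l₂, .nopEpi), C₃)]))

section IteCode

variable {C : CompRec Val Var Lock Op Reg}
    {l : Option ℕ} {nl : ℕ} {e : Expr Val Var Op} {c₁ c₂ : Cmd Val Var Lock Op}
    {PCs Pe : List (LInstr Val Var Lock Op Reg × CompRec Val Var Lock Op Reg)} {r : Reg}
    {C₁ : CompRec Val Var Lock Op Reg}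
    {P₁ : List (LInstr Val Var Lock Op Reg × CompRec Val Var Lock Op Reg)} {l₁ : Option ℕ}
    {nl₁ : ℕ} {C₂ : CompRec Val Var Lock Op Reg}
    {P₂ : List (LInstr Val Var Lock Op Reg × CompRec Val Var Lock Op Reg)} {l₂ : Option ℕ}
    {nl₂ : ℕ} {C₃ : CompRec Val Var Lock Op Reg}

theorem IteCode.of_compileCmd {l' C'} (hr : Θ.inputReqs C l nl (.ite e c₁ c₂))
    (h : Θ.compileCmd C l nl (.ite e c₁ c₂) = some (PCs, l', nl₂, C'))
    (he : Θ.compileExpr C ∅ l e = some (Pe, r, C₁))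
    (h₁ : Θ.compileCmd C₁ none (nl + 2) c₁ = some (P₁, l₁, nl₁, C₂))
    (h₂ : Θ.compileCmd C₁ (some nl) nl₁ c₂ = some (P₂, l₂, nl₂, C₃)) :
    Θ.IteCode C l nl e c₁ c₂ PCs Pe r C₁ P₁ l₁ nl₁ C₂ P₂ l₂ nl₂ C₃ := by
  refine ⟨hr, he, h₁, h₂, ?_⟩
  obtain ⟨Pe', r', C₁', P₁', l₁', nl₁', C₂', P₂', l₂', C₃', he', h₁', h₂', rfl, -⟩ :=
    compileCmd_ite h
  cases he.symm.trans he'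
  cases h₁.symm.trans h₁'
  cases h₂.symm.trans h₂'
  simp [condCode]

variable (h : Θ.IteCode C l nl e c₁ c₂ PCs Pe r C₁ P₁ l₁ nl₁ C₂ P₂ l₂ nl₂ C₃)
include h

theorem IteCode.length_eq : PCs.length = Pe.length + 1 + P₁.length + 1 + P₂.length + 1 := by
  rw [h.code]
  simp
  omega

theorem IteCode.asmrec_eq : C₁.asmrec = C.asmrec := compileExpr_asmrec h.expr

/-- This is the demand of the static check that both branches act alike on the assumptions. It
justifies taking the assumption part of the final record from the first branch alone. -/
theorem IteCode.asmrec_snd : C₃.asmrec = C₂.asmrec := by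
  rw [compileCmd_asmrec h.fst, compileCmd_asmrec h.snd, h.asmrec_eq]
  exact h.reqs.2.2.1.2.2.2.symm

theorem IteCode.reqs_fst : Θ.inputReqs C₁ none (nl + 2) c₁ := by
  refine ⟨compileCmd_ne_halt h.fst, by simp, ?_, ?_⟩
  · rw [noUnstableExprs, h.asmrec_eq]; exact h.reqs.2.2.1.2.1
  · exact compileExpr_regrecStable h.expr h.reqs.2.2.1.1 h.reqs.2.2.2

theorem IteCode.labelSpec_fst : LabelSpec (P₁.map Prod.fst) none (nl + 2) l₁ nl₁ :=
  compileCmd_labelSpec h.fst h.reqs_fst.2.1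

theorem IteCode.reqs_snd : Θ.inputReqs C₁ (some nl) nl₁ c₂ := by
  refine ⟨compileCmd_ne_halt h.snd, ?_, ?_, h.reqs_fst.2.2.2⟩
  · have := h.labelSpec_fst.le
    intro x hx
    cases hx
    omega
  · rw [noUnstableExprs, h.asmrec_eq]; exact h.reqs.2.2.1.2.2.1

theorem IteCode.labelSpec_snd : LabelSpec (P₂.map Prod.fst) (some nl) nl₁ l₂ nl₂ :=
  compileCmd_labelSpec h.snd h.reqs_snd.2.1

/-- Labels before the branch lie below `nl`, and jumps of the branch aim at `nl + 2` or above. Its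
exit label, if any, sits on the following `jmp`. -/
theorem IteCode.fragmentAt_fst : FragmentAt PCs P₁ C₂ (Pe.length + 1) := by
  have s := h.labelSpec_fst
  refine ⟨_, _, _, h.code, length_condCode, fun x hx hx' => ?_, s.jumps⟩
  have := h.reqs.2.1 _ (labels_condCode h.expr hx')
  obtain hx | hx := s.jumps_range hx
  · cases hx
  · omega

/-- The gap at `nl` and `nl + 1` is what matters: the first occurrence of `nl` is the start of the
second branch, and `nl + 1` cannot be met before it. -/
theorem IteCode.labels_prefix {x : ℕ} (hx : labels ((condCode Pe l nl r C₁ ++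
    (P₁ ++ [((l₁, Instr.jmp (nl + 1)), C₂)])).map Prod.fst) x) : x < nl ∨ nl + 2 ≤ x ∧ x < nl₁ := by
  rw [List.map_append, labels_append, List.map_append, labels_append] at hx
  have s := h.labelSpec_fst
  obtain hx | hx | hx := hx
  · exact .inl (h.reqs.2.1 _ (labels_condCode h.expr hx))
  · obtain hx | hx := s.labels x hx
    · cases hx
    · exact .inr hx
  · exact .inr (s.exit x (by simpa [labels_cons] using hx))

theorem IteCode.code_snd : PCs = (condCode Pe l nl r C₁ ++
    (P₁ ++ [((l₁, .jmp (nl + 1)), C₂)])) ++ (P₂ ++ [((l₂, .nopEpi), C₃)]) := by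
  rw [h.code]; simp

theorem IteCode.fragmentAt_snd :
    FragmentAt PCs P₂ C₃ (Pe.length + 1 + P₁.length + 1) := by
  have s := h.labelSpec_snd
  refine ⟨_, _, _, h.code_snd, by simp; omega, fun x hx hx' => ?_, s.jumps⟩
  have := h.labels_prefix hx'
  have := h.labelSpec_fst.le
  obtain hx | hx := s.jumps_range hx
  · cases hx
    omega
  · omega

theorem IteCode.resolve_else : resolve (PCs.map Prod.fst) nl = Pe.length + 1 + P₁.length + 1 := by
  rw [h.code_snd, List.map_append, resolve_append_of_not_labels, resolve_of_head]
  · simp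
    omega
  · obtain ⟨i, hi⟩ := h.labelSpec_snd.head nl rfl
    exact ⟨i, by rw [List.map_append, List.head?_append, hi]; rfl⟩
  · intro hx
    have := h.labels_prefix hx
    omega

/-- The exit label is reserved but attached to nothing here, so the jump falls to the end of the
code by the convention for missing labels. -/
theorem IteCode.resolve_exit : resolve (PCs.map Prod.fst) (nl + 1) = PCs.length := by
  rw [resolve_of_not_labels, List.length_map]
  have s := h.labelSpec_snd
  have := h.labelSpec_fst.le
  rw [h.code_snd, List.map_append, labels_append, List.map_append (l₁ := P₂), labels_append]
  rintro (hx | hx | hx)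
  · have := h.labels_prefix hx
    omega
  · obtain hx | hx := s.labels _ hx
    · cases hx
    · omega
  · have := s.exit (nl + 1) (by simpa [labels_cons] using hx)
    omega

theorem IteCode.step_expr {pc regs mds mem lcr'} (hpc : pc < Pe.length)
    (hg : Θ.guardsAt PCs pc regs mds mem)
    (hs : Θ.RStep ⟨⟨pc, PCs.map Prod.fst, regs⟩, mds, mem⟩ lcr') :
    (∃ regs', lcr' = ⟨⟨pc + 1, PCs.map Prod.fst, regs'⟩, mds, mem⟩ ∧
      Θ.guardsAt PCs (pc + 1) regs' mds mem) ∧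
    ∃ lo j, (PCs.map Prod.fst)[pc]? = some (lo, j) ∧ isExprInstr j := by
  have hc := h.code
  subst hc
  exact condCode_step h.expr h.reqs.2.2.1.1 hpc hg hs

theorem IteCode.getElem?_jz : ∃ lo, (PCs.map Prod.fst)[Pe.length]? = some (lo, .jz nl r) := by
  rw [h.code]
  exact ⟨_, getElem?_map_fst getElem?_condCode_append⟩

theorem IteCode.getElem?_jmp : PCs[Pe.length + 1 + P₁.length]? =
    some ((l₁, .jmp (nl + 1)), C₂) := by
  rw [h.code, List.getElem?_append_right (by simp)]; simp

theorem IteCode.getElem?_nopEpi : PCs[Pe.length + 1 + P₁.length + 1 + P₂.length]? =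
    some ((l₂, .nopEpi), C₃) := by
  rw [h.code_snd, List.getElem?_append_right (by simp; omega),
    List.getElem?_append_right (by simp; omega), List.getElem?_eq_some_iff]
  refine ⟨by simp; omega, by simp⟩

theorem IteCode.step_branch {regs mds mem lcr'}
    (hg : Θ.guardsAt PCs Pe.length regs mds mem)
    (hs : Θ.RStep ⟨⟨Pe.length, PCs.map Prod.fst, regs⟩, mds, mem⟩ lcr') :
    Θ.configConsistent C₁ regs mds mem ∧ Θ.regrecStable C₁ ∧
    (Θ.isTrue (e.ev Θ mem) ∧ lcr' = ⟨⟨Pe.length + 1, PCs.map Prod.fst, regs⟩, mds, mem⟩ ∧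
      Θ.guardsAt PCs (Pe.length + 1) regs mds mem ∨
     ¬ Θ.isTrue (e.ev Θ mem) ∧
      lcr' = ⟨⟨Pe.length + 1 + P₁.length + 1, PCs.map Prod.fst, regs⟩, mds, mem⟩ ∧
      Θ.guardsAt PCs (Pe.length + 1 + P₁.length + 1) regs mds mem) := by
  have h₁ := h.fragmentAt_fst
  have h₂ := h.fragmentAt_snd
  have hres := h.resolve_else
  have hc := h.code
  subst hc
  obtain ⟨hD, hDs, hb⟩ := condCode_branch h.expr hg hs
  rw [hres] at hb
  refine ⟨hD, hDs, hb.imp (fun hb => ⟨hb.1, hb.2, ?_⟩) fun hb => ⟨hb.1, hb.2, ?_⟩⟩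
  · exact h₁.guardsAt ((compileCmd_guardsAt_zero h.fst hD hDs).okAt C₂)
  · exact h₂.guardsAt ((compileCmd_guardsAt_zero h.snd hD hDs).okAt C₃)

theorem IteCode.step_jmp {regs mds mem lcr'}
    (hs : Θ.RStep ⟨⟨Pe.length + 1 + P₁.length, PCs.map Prod.fst, regs⟩, mds, mem⟩ lcr') :
    lcr' = ⟨⟨PCs.length, PCs.map Prod.fst, regs⟩, mds, mem⟩ := by
  obtain ⟨pc', regs', mds', mem', rfl, hx⟩ := hs.exec (getElem?_map_fst h.getElem?_jmp)
  cases hx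
  rw [h.resolve_exit]

theorem IteCode.step_nopEpi {regs mds mem lcr'}
    (hs : Θ.RStep ⟨⟨Pe.length + 1 + P₁.length + 1 + P₂.length, PCs.map Prod.fst, regs⟩, mds, mem⟩
      lcr') :
    lcr' = ⟨⟨PCs.length, PCs.map Prod.fst, regs⟩, mds, mem⟩ := by
  obtain ⟨pc', regs', mds', mem', rfl, hx⟩ := hs.exec (getElem?_map_fst h.getElem?_nopEpi)
  cases hx
  rw [h.length_eq]

end IteCode

/-! ### Code of a loop -/

/-- The parts of a compiled loop. -/
structure WhileCode (Θ : Params Val Var Lock Op Reg) (C : CompRec Val Var Lock Op Reg)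
    (l : Option ℕ) (nl : ℕ) (e : Expr Val Var Op) (c : Cmd Val Var Lock Op)
    (PCs Pe : List (LInstr Val Var Lock Op Reg × CompRec Val Var Lock Op Reg)) (r : Reg)
    (C₁ : CompRec Val Var Lock Op Reg)
    (Pc : List (LInstr Val Var Lock Op Reg × CompRec Val Var Lock Op Reg)) (lc : Option ℕ)
    (nlc : ℕ) (C₂ : CompRec Val Var Lock Op Reg) : Prop where
  reqs : Θ.inputReqs C l nl (.while e c)
  expr : Θ.compileExpr ⟨fun _ => none, C.asmrec⟩ ∅ (some (l.getD nl)) e = some (Pe, r, C₁)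
  body : Θ.compileCmd C₁ none (nl + 2) c = some (Pc, lc, nlc, C₂)
  code : PCs = condCode Pe (some (l.getD nl)) (nl + 1) r C₁ ++
    (Pc ++ [((lc, .jmp (l.getD nl)), C₂)])

section WhileCode

variable {C : CompRec Val Var Lock Op Reg}
    {l : Option ℕ} {nl : ℕ} {e : Expr Val Var Op} {c : Cmd Val Var Lock Op}
    {PCs Pe : List (LInstr Val Var Lock Op Reg × CompRec Val Var Lock Op Reg)} {r : Reg}
    {C₁ : CompRec Val Var Lock Op Reg}
    {Pc : List (LInstr Val Var Lock Op Reg × CompRec Val Var Lock Op Reg)} {lc : Option ℕ}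
    {nlc : ℕ} {C₂ : CompRec Val Var Lock Op Reg}

theorem WhileCode.of_compileCmd {l' nl' C'} (hr : Θ.inputReqs C l nl (.while e c))
    (h : Θ.compileCmd C l nl (.while e c) = some (PCs, l', nl', C'))
    (he : Θ.compileExpr ⟨fun _ => none, C.asmrec⟩ ∅ (some (l.getD nl)) e = some (Pe, r, C₁))
    (h₁ : Θ.compileCmd C₁ none (nl + 2) c = some (Pc, lc, nlc, C₂)) :
    Θ.WhileCode C l nl e c PCs Pe r C₁ Pc lc nlc C₂ := by
  refine ⟨hr, he, h₁, ?_⟩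
  obtain ⟨Pe', r', Pc', lc', C₂', he', h₁', rfl, -⟩ := compileCmd_while h
  cases he.symm.trans he'
  cases h₁.symm.trans h₁'
  simp [condCode, compileExpr_ne_nil he fun _ => rfl]

variable (h : Θ.WhileCode C l nl e c PCs Pe r C₁ Pc lc nlc C₂)
include h

theorem WhileCode.length_eq : PCs.length = Pe.length + 1 + Pc.length + 1 := by
  rw [h.code]
  simp
  omega

/-- The unfolding of the loop is matched by the first instruction of the condition, so such an
instruction has to exist. -/
theorem WhileCode.expr_length_pos : 0 < Pe.length :=
  List.length_pos_iff.2 (compileExpr_ne_nil h.expr fun _ => rfl)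

theorem WhileCode.asmrec_eq : C₁.asmrec = C.asmrec := by
  have := compileExpr_asmrec h.expr
  exact this

theorem WhileCode.asmrec_body : C₂.asmrec = C.asmrec := by
  rw [compileCmd_asmrec h.body, h.asmrec_eq]
  exact h.reqs.2.2.1.2.2

theorem WhileCode.reqs_body : Θ.inputReqs C₁ none (nl + 2) c := by
  refine ⟨compileCmd_ne_halt h.body, by simp, ?_, ?_⟩
  · rw [noUnstableExprs, h.asmrec_eq]; exact h.reqs.2.2.1.2.1
  · exact compileExpr_regrecStable h.expr h.reqs.2.2.1.1 (regrecStable_empty _)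

theorem WhileCode.labelSpec_body : LabelSpec (Pc.map Prod.fst) none (nl + 2) lc nlc :=
  compileCmd_labelSpec h.body h.reqs_body.2.1

theorem WhileCode.labels_prefix {x : ℕ}
    (hx : labels ((condCode Pe (some (l.getD nl)) (nl + 1) r C₁).map Prod.fst) x) : x ≤ nl := by
  cases labels_condCode h.expr hx
  cases hl : l with
  | none => exact le_rfl
  | some x => exact (h.reqs.2.1 x hl).le

theorem WhileCode.fragmentAt_body : FragmentAt PCs Pc C₂ (Pe.length + 1) := by
  have s := h.labelSpec_body
  refine ⟨_, _, _, h.code, length_condCode, fun x hx hx' => ?_, s.jumps⟩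
  have := h.labels_prefix hx'
  obtain hx | hx := s.jumps_range hx
  · cases hx
  · omega

/-- The code of the condition is nonempty and carries the loop label on its first instruction. -/
theorem WhileCode.resolve_entry : resolve (PCs.map Prod.fst) (l.getD nl) = 0 := by
  refine resolve_of_head ?_
  rw [h.code, condCode, List.append_assoc, List.singleton_append]
  exact head?_expr_append h.expr fun h' => absurd h' (compileExpr_ne_nil h.expr fun _ => rfl)

theorem WhileCode.resolve_exit : resolve (PCs.map Prod.fst) (nl + 1) = PCs.length := by
  rw [resolve_of_not_labels, List.length_map]
  have s := h.labelSpec_body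
  rw [h.code, List.map_append, labels_append, List.map_append, labels_append]
  rintro (hx | hx | hx)
  · have := h.labels_prefix hx
    omega
  · obtain hx | hx := s.labels _ hx
    · cases hx
    · omega
  · have := s.exit (nl + 1) (by simpa [labels_cons] using hx)
    omega

theorem WhileCode.step_expr {pc regs mds mem lcr'} (hpc : pc < Pe.length)
    (hg : Θ.guardsAt PCs pc regs mds mem)
    (hs : Θ.RStep ⟨⟨pc, PCs.map Prod.fst, regs⟩, mds, mem⟩ lcr') :
    (∃ regs', lcr' = ⟨⟨pc + 1, PCs.map Prod.fst, regs'⟩, mds, mem⟩ ∧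
      Θ.guardsAt PCs (pc + 1) regs' mds mem) ∧
    ∃ lo j, (PCs.map Prod.fst)[pc]? = some (lo, j) ∧ isExprInstr j := by
  have hc := h.code
  subst hc
  exact condCode_step h.expr h.reqs.2.2.1.1 hpc hg hs

theorem WhileCode.getElem?_jz :
    ∃ lo, (PCs.map Prod.fst)[Pe.length]? = some (lo, .jz (nl + 1) r) := by
  rw [h.code]
  exact ⟨_, getElem?_map_fst getElem?_condCode_append⟩

theorem WhileCode.getElem?_jmp : PCs[Pe.length + 1 + Pc.length]? =
    some ((lc, .jmp (l.getD nl)), C₂) := by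
  rw [h.code, List.getElem?_append_right (by simp)]; simp

theorem WhileCode.step_branch {regs mds mem lcr'}
    (hg : Θ.guardsAt PCs Pe.length regs mds mem)
    (hs : Θ.RStep ⟨⟨Pe.length, PCs.map Prod.fst, regs⟩, mds, mem⟩ lcr') :
    Θ.configConsistent C₁ regs mds mem ∧ Θ.regrecStable C₁ ∧
    (Θ.isTrue (e.ev Θ mem) ∧ lcr' = ⟨⟨Pe.length + 1, PCs.map Prod.fst, regs⟩, mds, mem⟩ ∧
      Θ.guardsAt PCs (Pe.length + 1) regs mds mem ∨
     ¬ Θ.isTrue (e.ev Θ mem) ∧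
      lcr' = ⟨⟨PCs.length, PCs.map Prod.fst, regs⟩, mds, mem⟩) := by
  have h₁ := h.fragmentAt_body
  have hres := h.resolve_exit
  have hc := h.code
  subst hc
  obtain ⟨hD, hDs, hb⟩ := condCode_branch h.expr hg hs
  rw [hres] at hb
  refine ⟨hD, hDs, hb.imp_left fun hb => ⟨hb.1, hb.2, ?_⟩⟩
  exact h₁.guardsAt ((compileCmd_guardsAt_zero h.body hD hDs).okAt C₂)

/-- The record at the loop entry has no register entries, so after the jump back only its assumption
part has to be checked, and this the body has restored. -/
theorem WhileCode.step_jmp {regs mds mem lcr'}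
    (hg : Θ.guardsAt PCs (Pe.length + 1 + Pc.length) regs mds mem)
    (hs : Θ.RStep ⟨⟨Pe.length + 1 + Pc.length, PCs.map Prod.fst, regs⟩, mds, mem⟩ lcr') :
    lcr' = ⟨⟨0, PCs.map Prod.fst, regs⟩, mds, mem⟩ ∧ Θ.guardsAt PCs 0 regs mds mem := by
  obtain ⟨pc', regs', mds', mem', rfl, hx⟩ := hs.exec (getElem?_map_fst h.getElem?_jmp)
  obtain ⟨i, D, hi, hD, hDs⟩ := hg
  rw [h.getElem?_jmp] at hi
  cases hi
  cases hx
  rw [h.resolve_entry]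
  refine ⟨rfl, okAt.guardsAt (C := C) ?_ (by rw [h.length_eq]; omega)⟩
  refine ⟨⟨fun _ => none, C.asmrec⟩, ?_, ⟨?_, h.asmrec_body.symm.trans hD.2⟩,
    regrecStable_empty _⟩
  · rw [h.code, annot_condCode_append h.expr]
  · exact fun r e he => (Option.some_ne_none e he.symm).elim

end WhileCode

/-! ### Preservation of the annotations -/

theorem configConsistent.asmrec {C : CompRec Val Var Lock Op Reg} {regs mds mem}
    (h : Θ.configConsistent C regs mds mem) : C.asmrec = (mds .AsmNoW, mds .AsmNoRW) := h.2

/-- Consistency for a register record that is preserved by an update of one shared variable. -/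
theorem configConsistent.upd_mem {C : CompRec Val Var Lock Op Reg} {regs mds mem}
    (h : Θ.configConsistent C regs mds mem) {Φ : RegRec Val Var Op Reg} {S : AsmRec Var Lock}
    {mds' : MdsState Var Lock} {x : SVar Var Lock} {n : Val}
    (hS : S = (mds' .AsmNoW, mds' .AsmNoRW))
    (hΦ : ∀ r e, Φ r = some e → C.regrec r = some e ∧ ∀ v ∈ e.vars, SVar.prog v ≠ x) :
    Θ.configConsistent ⟨Φ, S⟩ regs mds' (WRCompiler.upd mem x n) := by
  refine ⟨fun r e he => ?_, hS⟩
  obtain ⟨he, hx⟩ := hΦ r e he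
  rw [h.1 r e he]
  exact ev_congr fun v hv => (upd_of_ne _ _ (hx v hv)).symm

/-- This supplies the guards that the rules of the refinement relation demand after a step, without
reference to that relation. It uses `okAt`, since the step may lead past the last instruction. -/
theorem compileCmd_step {c : Cmd Val Var Lock Op} {C : CompRec Val Var Lock Op Reg}
    {l : Option ℕ} {nl : ℕ} {P l' nl' C'} (h : Θ.compileCmd C l nl c = some (P, l', nl', C'))
    (hr : Θ.inputReqs C l nl c) {pc regs mds mem pc' T regs' mds' mem'}
    (hg : Θ.guardsAt P pc regs mds mem)
    (hs : Θ.RStep ⟨⟨pc, P.map Prod.fst, regs⟩, mds, mem⟩ ⟨⟨pc', T, regs'⟩, mds', mem'⟩) :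
    Θ.okAt P C' pc' regs' mds' mem' := by
  induction c generalizing C l nl P l' nl' C' pc regs mds mem pc' T regs' mds' mem' with
  | halt => cases h
  | skip =>
    cases h
    obtain rfl : pc = 0 := Nat.lt_one_iff.1 hg.lt_length
    obtain ⟨i, D, hi, hD⟩ := hg
    cases hi
    obtain ⟨_, _, _, _, ⟨⟩, hx⟩ := hs.exec rfl
    cases hx
    exact ⟨_, rfl, hD⟩
  | lockAcq k =>
    cases h
    obtain rfl : pc = 0 := Nat.lt_one_iff.1 hg.lt_length
    have hg' := hg
    obtain ⟨i, D, hi, hD, hDs⟩ := hg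
    cases hi
    obtain ⟨_, _, _, _, ⟨⟩, hx⟩ := hs.exec rfl
    cases hx with
    | lockAcq =>
      refine ⟨_, rfl, hD.upd_mem ?_ fun r e he => ⟨he, by simp⟩,
        fun r e he => (hDs r e he).acqAsm k⟩
      simp [acqAsm, acqMds, hD.asmrec]
    -- A spinning step changes nothing, so the old guard still applies.
    | lockAcq_spin => exact hg'.okAt _
  | lockRel k =>
    cases h
    obtain rfl : pc = 0 := Nat.lt_one_iff.1 hg.lt_length
    have hg' := hg
    obtain ⟨i, D, hi, hD, hDs⟩ := hg
    cases hi
    obtain ⟨_, _, _, _, ⟨⟩, hx⟩ := hs.exec rfl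
    cases hx with
    | lockRel =>
      refine ⟨_, rfl, hD.upd_mem ?_ fun r e he => ⟨(keep_eq_some.1 he).1, by simp⟩,
        fun r e he => (keep_eq_some.1 he).2⟩
      simp [relAsm, relMds, hD.asmrec]
    | lockRel_spin => exact hg'.okAt _
  | assign v e =>
    obtain ⟨Pe, r, C₁, he, hw, rfl, rfl, rfl, rfl⟩ := compileCmd_assign h
    by_cases hpc : pc < Pe.length
    · obtain ⟨⟨_, ⟨⟩, hg⟩, -⟩ := compileExpr_step he hr.2.2.1 hpc hg hs
      exact hg.okAt _
    · obtain rfl : pc = Pe.length := by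
        have := hg.lt_length
        simp at this
        omega
      obtain ⟨i, D, hi, hD, hDs⟩ := hg
      have hi' := getElem?_map_fst hi
      simp only [List.getElem?_concat_length, Option.some.injEq, Prod.mk.injEq] at hi
      obtain ⟨rfl, rfl⟩ := hi
      obtain ⟨_, _, _, _, ⟨⟩, hx⟩ := hs.exec hi'
      cases hx
      -- Entries mentioning the stored variable have been discarded, so the kept ones evaluate as
      -- before.
      refine okAt_append_right.2 ⟨_, rfl, hD.upd_mem hD.asmrec fun r e he => ?_, hDs.keep _⟩
      obtain ⟨he, hv⟩ := keep_eq_some.1 he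
      refine ⟨he, fun w hw h => hv ?_⟩
      cases h
      exact hw
  | seq c₁ c₂ ih₁ ih₂ =>
    obtain ⟨P₁, l₁, nl₁, C₁, P₂, h₁, h₂, rfl⟩ := compileCmd_seq h
    have hr₁ : Θ.inputReqs C l nl c₁ := ⟨compileCmd_ne_halt h₁, hr.2.1, hr.2.2.1.1, hr.2.2.2⟩
    have s₁ := compileCmd_labelSpec h₁ hr.2.1
    have hr₂ : Θ.inputReqs C₁ l₁ nl₁ c₂ := by
      refine ⟨compileCmd_ne_halt h₂, fun x hx => (s₁.exit x hx).2, ?_,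
        compileCmd_regrecStable h₁ hr.2.2.1.1 hr.2.2.2⟩
      rw [noUnstableExprs, compileCmd_asmrec h₁]
      exact hr.2.2.1.2
    have s₂ := compileCmd_labelSpec h₂ hr₂.2.1
    rw [List.map_append] at hs
    by_cases hpc : pc < P₁.length
    · obtain ⟨_, _, _, _, ⟨⟩, hs⟩ := hs.of_append_left (s₁.joinableForward s₂) (by simpa using hpc)
      refine ((ih₁ h₁ hr₁ ?_ hs).guardsAt_append h₂).okAt _
      obtain ⟨i, D, hi, hD⟩ := hg
      exact ⟨i, D, by rwa [List.getElem?_append_left hpc] at hi, hD⟩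
    · obtain ⟨q, rfl⟩ := Nat.exists_eq_add_of_le (not_lt.1 hpc)
      have hlt := hg.lt_length
      rw [List.length_append] at hlt
      rw [← List.length_map (f := Prod.fst) (as := P₁)] at hs
      obtain ⟨_, _, _, _, ⟨⟩, hs⟩ := hs.of_append_right (s₁.joinableBackward s₂ hr.2.1)
      rw [List.length_map]
      exact okAt_append_right.2
        (ih₂ h₂ hr₂ ((okAt_append_right.1 (hg.okAt C')).guardsAt (by omega)) hs)
  | ite e c₁ c₂ ih₁ ih₂ =>
    obtain ⟨Pe, r, C₁, P₁, l₁, nl₁, C₂, P₂, l₂, C₃, he, h₁, h₂, -, rfl, rfl⟩ := compileCmd_ite h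
    have hc := IteCode.of_compileCmd hr h he h₁ h₂
    -- The end is reached from either branch, and the final record keeps only what both branches
    -- record. Their assumption parts agree by the static check.
    have hexit : Θ.configConsistent C₂ regs mds mem ∧ Θ.regrecStable C₂ ∨
        Θ.configConsistent C₃ regs mds mem ∧ Θ.regrecStable C₃ →
        Θ.okAt P ⟨meet C₂.regrec C₃.regrec, C₂.asmrec⟩ P.length regs mds mem := by
      rw [okAt_length]
      have ha := hc.asmrec_snd
      rintro (⟨hD, hDs⟩ | ⟨hD, hDs⟩)
      · exact ⟨⟨fun r e he => hD.1 r e (meet_eq_some.1 he).1, hD.2⟩,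
          fun r e he => hDs r e (meet_eq_some.1 he).1⟩
      · rw [← ha]
        exact ⟨⟨fun r e he => hD.1 r e (meet_eq_some.1 he).2, hD.2⟩,
          fun r e he => hDs r e (meet_eq_some.1 he).2⟩
    have hlt := hg.lt_length
    rw [hc.length_eq] at hlt
    rcases lt_trichotomy pc Pe.length with hpc | rfl | hpc
    · obtain ⟨⟨_, ⟨⟩, hg⟩, -⟩ := hc.step_expr hpc hg hs
      exact hg.okAt _
    · obtain ⟨-, -, ⟨-, ⟨⟩, hg⟩ | ⟨-, ⟨⟩, hg⟩⟩ := hc.step_branch hg hs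
      · exact hg.okAt _
      · exact hg.okAt _
    obtain ⟨q, rfl⟩ := Nat.exists_eq_add_of_le (Nat.succ_le_of_lt hpc)
    rcases lt_trichotomy q P₁.length with hq | rfl | hq
    · obtain ⟨q', _, _, _, ⟨⟩, hs⟩ := hc.fragmentAt_fst.step hq hs
      have := ih₁ h₁ hc.reqs_fst ((hc.fragmentAt_fst.guardsAt_iff hq).1 hg) hs
      exact (hc.fragmentAt_fst.guardsAt this).okAt _
    · cases hc.step_jmp hs
      obtain ⟨i, D, hi, hD⟩ := hg
      cases hc.getElem?_jmp.symm.trans hi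
      exact hexit (.inl hD)
    obtain ⟨s, rfl⟩ := Nat.exists_eq_add_of_le (Nat.succ_le_of_lt hq)
    have e₀ : Pe.length.succ + (P₁.length.succ + s) = Pe.length + 1 + P₁.length + 1 + s := by omega
    rw [e₀] at hs hg hlt
    rcases lt_or_eq_of_le (show s ≤ P₂.length by omega) with hs' | rfl
    · obtain ⟨q', _, _, _, ⟨⟩, hs⟩ := hc.fragmentAt_snd.step hs' hs
      have := ih₂ h₂ hc.reqs_snd ((hc.fragmentAt_snd.guardsAt_iff hs').1 hg) hs
      exact (hc.fragmentAt_snd.guardsAt this).okAt _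
    · cases hc.step_nopEpi hs
      obtain ⟨i, D, hi, hD⟩ := hg
      cases hc.getElem?_nopEpi.symm.trans hi
      exact hexit (.inr hD)
  | _ =>
    rename_i e c ih
    obtain ⟨Pe, r, Pc, lc, C₂, he, h₁, -, rfl⟩ := compileCmd_while h
    have hc := WhileCode.of_compileCmd hr h he h₁
    have hlt := hg.lt_length
    rw [hc.length_eq] at hlt
    rcases lt_trichotomy pc Pe.length with hpc | rfl | hpc
    · obtain ⟨⟨_, ⟨⟩, hg⟩, -⟩ := hc.step_expr hpc hg hs
      exact hg.okAt _
    · obtain ⟨hD, hDs, ⟨-, ⟨⟩, hg⟩ | ⟨-, ⟨⟩⟩⟩ := hc.step_branch hg hs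
      · exact hg.okAt _
      -- A loop is left only through its `jz`, where the current record is the final one.
      · exact okAt_length.2 ⟨hD, hDs⟩
    obtain ⟨q, rfl⟩ := Nat.exists_eq_add_of_le (Nat.succ_le_of_lt hpc)
    rcases lt_or_eq_of_le (show q ≤ Pc.length by omega) with hq | rfl
    · obtain ⟨q', _, _, _, ⟨⟩, hs⟩ := hc.fragmentAt_body.step hq hs
      have := ih h₁ hc.reqs_body ((hc.fragmentAt_body.guardsAt_iff hq).1 hg) hs
      exact (hc.fragmentAt_body.guardsAt this).okAt _
    · obtain ⟨⟨⟩, hg⟩ := hc.step_jmp hg hs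
      exact hg.okAt _

end Params

/-! ### Pacing -/

section pacing

variable {lcw lcw' : WConf Val Var Lock Op} {lcr lcr' : RConf Val Var Lock Op Reg}
  {lo : Option ℕ} {i : Instr Val Var Lock Op Reg}

theorem absSteps_congr (hc : leftmostCmd lcw.tps = leftmostCmd lcw'.tps)
    (hi : lcr.tps.text[lcr.tps.pc]? = lcr'.tps.text[lcr'.tps.pc]?) :
    absSteps lcw lcr = absSteps lcw' lcr' := by
  simp only [absSteps, exprPace, hc, hi]

theorem absSteps_of_isEpilogue (hi : lcr.tps.text[lcr.tps.pc]? = some (lo, i))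
    (h : isEpilogue i) : absSteps lcw lcr = 0 := by
  simp only [absSteps, hi]
  cases i <;> first | rfl | exact h.elim

theorem absSteps_of_isExprInstr (hi : lcr.tps.text[lcr.tps.pc]? = some (lo, i))
    (h : isExprInstr i) : absSteps lcw lcr = exprPace lcw.tps := by
  simp only [absSteps, hi]
  cases i <;> first | rfl | exact h.elim

theorem absSteps_eq_one (hi : lcr.tps.text[lcr.tps.pc]? = some (lo, i))
    (h : ¬ isEpilogue i) (h' : ¬ isExprInstr i) : absSteps lcw lcr = 1 := by
  simp only [absSteps, hi]
  cases i <;> first | rfl | exact (h trivial).elim | exact (h' trivial).elim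

theorem nSteps_one {α : Type*} {step : α → α → Prop} {a b : α} (h : step a b) :
    nSteps step 1 a b :=
  ⟨b, h, rfl⟩

end pacing

@[simp] theorem seqRest_halt (c : Cmd Val Var Lock Op) : seqRest .halt c = c := if_pos rfl

theorem seqRest_of_ne_halt {c₁ : Cmd Val Var Lock Op} (h : c₁ ≠ .halt)
    (c₂ : Cmd Val Var Lock Op) : seqRest c₁ c₂ = .seq c₁ c₂ := if_neg h

/-- While `c₁` is running, it determines the leftmost command. Once it is `halt`, the leftmost
command is that of `c₂` and could change the pace; at a silent instruction the pace is `0`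
regardless. -/
theorem absSteps_seqRest {c₁ : Cmd Val Var Lock Op} (c₂ : Cmd Val Var Lock Op)
    {mds mds' mem mem'} {lcr lcr' : RConf Val Var Lock Op Reg}
    (hi : lcr.tps.text[lcr.tps.pc]? = lcr'.tps.text[lcr'.tps.pc]?)
    (h : c₁ = .halt → ∃ lo i, lcr'.tps.text[lcr'.tps.pc]? = some (lo, i) ∧ isEpilogue i) :
    absSteps ⟨seqRest c₁ c₂, mds, mem⟩ lcr = absSteps ⟨c₁, mds', mem'⟩ lcr' := by
  by_cases hc : c₁ = .halt
  · obtain ⟨lo, i, hi', he⟩ := h hc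
    rw [absSteps_of_isEpilogue hi' he, absSteps_of_isEpilogue (hi.trans hi') he]
  · rw [seqRest_of_ne_halt hc]
    exact absSteps_congr rfl hi

namespace Params

variable {Θ : Params Val Var Lock Op Reg}

theorem not_wStep_halt {mds mem} {lcw' : WConf Val Var Lock Op} :
    ¬ Θ.WStep ⟨.halt, mds, mem⟩ lcw' := by
  intro h
  cases h

/-- With `seqRest` the two rules for sequences, for a first component that continues and for one
that terminates, become a single congruence. -/
theorem WStep.seqRest {c c' : Cmd Val Var Lock Op} {mds mds' mem mem'}
    (h : Θ.WStep ⟨c, mds, mem⟩ ⟨c', mds', mem'⟩) (d : Cmd Val Var Lock Op) :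
    Θ.WStep ⟨seqRest c d, mds, mem⟩ ⟨seqRest c' d, mds', mem'⟩ := by
  have hc : c ≠ .halt := by
    rintro rfl
    exact not_wStep_halt h
  rw [seqRest_of_ne_halt hc]
  by_cases hc' : c' = .halt
  · subst hc'
    rw [seqRest_halt]
    exact .seq_halt _ _ _ _ _ _ h
  · rw [seqRest_of_ne_halt hc']
    exact .seq _ _ _ _ _ _ _ h hc'

theorem nSteps_seqRest {n : ℕ} {c c' : Cmd Val Var Lock Op} {mds mds' mem mem'}
    (h : nSteps Θ.WStep n ⟨c, mds, mem⟩ ⟨c', mds', mem'⟩) (d : Cmd Val Var Lock Op) :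
    nSteps Θ.WStep n ⟨seqRest c d, mds, mem⟩ ⟨seqRest c' d, mds', mem'⟩ := by
  induction n generalizing c mds mem with
  | zero => cases h; rfl
  | succ n ih =>
    obtain ⟨⟨c₁, mds₁, mem₁⟩, h₁, h⟩ := h
    exact ⟨_, h₁.seqRest d, ih h⟩

/-! ### Invariants of the refinement relation -/

theorem Rwr.mds_eq {lcw : WConf Val Var Lock Op} {lcr : RConf Val Var Lock Op Reg}
    (h : Θ.Rwr lcw lcr) : lcw.mds = lcr.mds := by
  cases h <;> rfl

theorem Rwr.mem_eq {lcw : WConf Val Var Lock Op} {lcr : RConf Val Var Lock Op Reg}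
    (h : Θ.Rwr lcw lcr) : lcw.mem = lcr.mem := by
  cases h <;> rfl

theorem guardsAt.pc_ne_length
    {P : List (LInstr Val Var Lock Op Reg × CompRec Val Var Lock Op Reg)} {pc regs mds mem}
    (h : Θ.guardsAt P pc regs mds mem) : pc ≠ (P.map Prod.fst).length := by
  rw [List.length_map]
  exact h.lt_length.ne

/-- Only the terminated program is related to the end of the code. -/
theorem Rwr.eq_halt {lcw : WConf Val Var Lock Op} {lcr : RConf Val Var Lock Op Reg}
    (h : Θ.Rwr lcw lcr) (hpc : lcr.tps.pc = lcr.tps.text.length) : lcw.tps = .halt := by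
  induction h with
  | halt => rfl
  | epilogue_step => rfl
  | seq _ _ _ _ _ _ _ _ _ _ _ _ _ _ _ _ _ _ _ _ _ _ _ hlt =>
    simp only [List.length_append, List.length_map] at hpc
    omega
  | join _ _ _ _ _ _ _ _ _ _ ih =>
    simp only [List.length_append] at hpc ih
    exact ih (by omega)
  | skip_nop => exact absurd hpc (guardsAt.pc_ne_length (by assumption))
  | assign_expr => exact absurd hpc (guardsAt.pc_ne_length (by assumption))
  | assign_store => exact absurd hpc (guardsAt.pc_ne_length (by assumption))
  | lock_acq => exact absurd hpc (guardsAt.pc_ne_length (by assumption))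
  | lock_rel => exact absurd hpc (guardsAt.pc_ne_length (by assumption))
  | if_expr => exact absurd hpc (guardsAt.pc_ne_length (by assumption))
  | if_c1 => exact absurd hpc (guardsAt.pc_ne_length (by assumption))
  | if_c2 => exact absurd hpc (guardsAt.pc_ne_length (by assumption))
  | while_expr => exact absurd hpc (guardsAt.pc_ne_length (by assumption))
  | while_inner => exact absurd hpc (guardsAt.pc_ne_length (by assumption))
  | while_loop => exact absurd hpc (guardsAt.pc_ne_length (by assumption))

/-- The terminated program is related to silent instructions only. -/
theorem Rwr.isEpilogue_of_halt {lcw : WConf Val Var Lock Op} {lcr : RConf Val Var Lock Op Reg}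
    (h : Θ.Rwr lcw lcr) (hc : lcw.tps = .halt) (hpc : lcr.tps.pc < lcr.tps.text.length) :
    ∃ lo i, lcr.tps.text[lcr.tps.pc]? = some (lo, i) ∧ isEpilogue i := by
  induction h with
  | halt => exact absurd hpc (lt_irrefl _)
  | epilogue_step _ _ _ _ _ _ _ hi he => exact ⟨_, _, hi, he⟩
  | seq C l nl c₁ c₂ P₁ l₁ nl₁ C₁ P₂ l₂ nl₂ C₂ c₁' pc regs mds mem hr h₁ h₂ =>
    -- What remains is a sequence or `c₂`, and `c₂` is not `halt` because it compiles.
    exfalso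
    simp only [WRCompiler.seqRest] at hc
    split at hc
    · exact compileCmd_ne_halt h₂ hc
    · cases hc
  | join c P₁ P₂ pc regs mds mem hj hle _ ih =>
    simp only [List.length_append] at hpc ih
    obtain ⟨lo, i, hi, he⟩ := ih hc (by omega)
    exact ⟨lo, i, by rw [List.getElem?_append_right hle]; exact hi, he⟩
  | if_c1 C l nl e c₁ c₂ PCs l' C' Pe r C₁ P₁ l₁ nl₁ C₂ P₂ l₂ nl₂ C₃ c₁' pc regs mds mem
      hr h he h₁ h₂ hlt hg _ ih =>
    obtain ⟨lo, i, hi, he'⟩ := ih hc (by simpa using hlt)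
    exact ⟨lo, i, ((IteCode.of_compileCmd hr h he h₁ h₂).fragmentAt_fst.getElem?_eq hlt).trans hi,
      he'⟩
  | if_c2 C l nl e c₁ c₂ PCs l' C' Pe r C₁ P₁ l₁ nl₁ C₂ P₂ l₂ nl₂ C₃ c₁' pc regs mds mem
      hr h he h₁ h₂ hlt hg _ ih =>
    obtain ⟨lo, i, hi, he'⟩ := ih hc (by simpa using hlt)
    exact ⟨lo, i, ((IteCode.of_compileCmd hr h he h₁ h₂).fragmentAt_snd.getElem?_eq hlt).trans hi,
      he'⟩
  | while_expr _ _ _ _ _ _ _ _ _ _ _ _ _ _ _ _ _ _ _ _ _ _ _ _ _ _ hcw =>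
    obtain ⟨-, rfl⟩ | ⟨-, rfl⟩ := hcw <;> cases hc
  | _ => cases hc

theorem Rwr.halt_of_eq_length {P : List (LInstr Val Var Lock Op Reg)} {pc regs mds mem}
    (h : pc = P.length) : Θ.Rwr ⟨.halt, mds, mem⟩ ⟨⟨pc, P, regs⟩, mds, mem⟩ := by
  subst h
  exact .halt ..

/-- The terminated program is related to an instruction that only jumps to, or falls through to,
the end of the code. -/
theorem Rwr.halt_of_step {P : List (LInstr Val Var Lock Op Reg)} {pc lo i regs mds mem}
    (hi : P[pc]? = some (lo, i)) (he : isEpilogue i)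
    (h : ∀ lcr', Θ.RStep ⟨⟨pc, P, regs⟩, mds, mem⟩ lcr' →
      lcr' = ⟨⟨P.length, P, regs⟩, mds, mem⟩) :
    Θ.Rwr ⟨.halt, mds, mem⟩ ⟨⟨pc, P, regs⟩, mds, mem⟩ := by
  refine .epilogue_step _ _ _ _ _ _ _ hi he fun lcw' lcr' hs hn => ?_
  rw [absSteps_of_isEpilogue hi he] at hn
  cases hn
  rw [h lcr' hs]
  exact .halt ..

/-! ### Lifting the relation out of branches and loop bodies. -/

theorem IteCode.rwr_fst {C : CompRec Val Var Lock Op Reg}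
    {l nl e c₁ c₂ PCs Pe r C₁ P₁ l₁ nl₁ C₂ P₂ l₂ nl₂ C₃}
    (hc : Θ.IteCode C l nl e c₁ c₂ PCs Pe r C₁ P₁ l₁ nl₁ C₂ P₂ l₂ nl₂ C₃) {l' C'}
    (h : Θ.compileCmd C l nl (.ite e c₁ c₂) = some (PCs, l', nl₂, C')) {c pc regs mds mem}
    (hok : Θ.okAt P₁ C₂ pc regs mds mem)
    (hR : Θ.Rwr ⟨c, mds, mem⟩ ⟨⟨pc, P₁.map Prod.fst, regs⟩, mds, mem⟩) :
    Θ.Rwr ⟨c, mds, mem⟩ ⟨⟨Pe.length + 1 + pc, PCs.map Prod.fst, regs⟩, mds, mem⟩ := by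
  obtain hpc | rfl := hok.le_length.lt_or_eq
  · exact .if_c1 _ _ _ _ _ _ _ _ _ _ _ _ _ _ _ _ _ _ _ _ _ _ _ _ _ hc.reqs h hc.expr hc.fst
      hc.snd hpc (hc.fragmentAt_fst.guardsAt hok) hR
  -- At the end of the branch the rule `if_c1` no longer applies. The command has terminated and the
  -- position holds the `jmp` to the exit, so `epilogue_step` takes over.
  · cases hR.eq_halt (by simp)
    refine .halt_of_step (getElem?_map_fst hc.getElem?_jmp) trivial fun lcr' hs => ?_
    rw [hc.step_jmp hs, List.length_map]

theorem IteCode.rwr_snd {C : CompRec Val Var Lock Op Reg}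
    {l nl e c₁ c₂ PCs Pe r C₁ P₁ l₁ nl₁ C₂ P₂ l₂ nl₂ C₃}
    (hc : Θ.IteCode C l nl e c₁ c₂ PCs Pe r C₁ P₁ l₁ nl₁ C₂ P₂ l₂ nl₂ C₃) {l' C'}
    (h : Θ.compileCmd C l nl (.ite e c₁ c₂) = some (PCs, l', nl₂, C')) {c pc regs mds mem}
    (hok : Θ.okAt P₂ C₃ pc regs mds mem)
    (hR : Θ.Rwr ⟨c, mds, mem⟩ ⟨⟨pc, P₂.map Prod.fst, regs⟩, mds, mem⟩) :
    Θ.Rwr ⟨c, mds, mem⟩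
      ⟨⟨Pe.length + 1 + P₁.length + 1 + pc, PCs.map Prod.fst, regs⟩, mds, mem⟩ := by
  obtain hpc | rfl := hok.le_length.lt_or_eq
  · exact .if_c2 _ _ _ _ _ _ _ _ _ _ _ _ _ _ _ _ _ _ _ _ _ _ _ _ _ hc.reqs h hc.expr hc.fst
      hc.snd hpc (hc.fragmentAt_snd.guardsAt hok) hR
  · cases hR.eq_halt (by simp)
    refine .halt_of_step (getElem?_map_fst hc.getElem?_nopEpi) trivial fun lcr' hs => ?_
    rw [hc.step_nopEpi hs, List.length_map]

/-- A terminated body leaves the loop itself to be executed, which `while_loop` covers even at the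
end of the body's code. A running body cannot be at that end, so `while_inner` covers it. -/
theorem WhileCode.rwr_body {C : CompRec Val Var Lock Op Reg} {l nl e c PCs Pe r C₁ Pc lc nlc C₂}
    (hc : Θ.WhileCode C l nl e c PCs Pe r C₁ Pc lc nlc C₂) {l' nl' C'}
    (h : Θ.compileCmd C l nl (.while e c) = some (PCs, l', nl', C'))
    (hstart : ∀ mds' mem' regs', Θ.configConsistent C₁ regs' mds' mem' → Θ.regrecStable C₁ →
      Θ.Rwr ⟨c, mds', mem'⟩ ⟨⟨0, Pc.map Prod.fst, regs'⟩, mds', mem'⟩) {cI pc regs mds mem}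
    (hok : Θ.okAt Pc C₂ pc regs mds mem)
    (hR : Θ.Rwr ⟨cI, mds, mem⟩ ⟨⟨pc, Pc.map Prod.fst, regs⟩, mds, mem⟩) :
    Θ.Rwr ⟨seqRest cI (.while e c), mds, mem⟩
      ⟨⟨Pe.length + 1 + pc, PCs.map Prod.fst, regs⟩, mds, mem⟩ := by
  have hg := hc.fragmentAt_body.guardsAt hok
  by_cases hcI : cI = .halt
  · subst hcI
    rw [seqRest_halt]
    exact .while_loop _ _ _ _ _ _ _ _ _ _ _ _ _ _ _ _ _ _ _ _ hc.reqs h hc.expr hc.body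
      hok.le_length hg hR hstart
  · rw [seqRest_of_ne_halt hcI]
    refine .while_inner _ _ _ _ _ _ _ _ _ _ _ _ _ _ _ _ _ _ _ _ _ hc.reqs h hc.expr hc.body
      (hok.le_length.lt_of_ne ?_) hcI hg hR hstart
    rintro rfl
    exact hcI (hR.eq_halt (by simp))

/-! ### Simulation -/

/-- The conclusion of the simulation: `lcr'` is matched by the number of steps of `lcw` that the
pacing function prescribes. -/
def Simulates (Θ : Params Val Var Lock Op Reg) (lcw : WConf Val Var Lock Op)
    (lcr lcr' : RConf Val Var Lock Op Reg) : Prop :=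
  ∃ lcw' : WConf Val Var Lock Op, nSteps Θ.WStep (absSteps lcw lcr) lcw lcw' ∧ Θ.Rwr lcw' lcr'

theorem Simulates.of_zero {lcw : WConf Val Var Lock Op} {lcr lcr' : RConf Val Var Lock Op Reg}
    (hn : absSteps lcw lcr = 0) (h : Θ.Rwr lcw lcr') : Θ.Simulates lcw lcr lcr' :=
  ⟨lcw, by rw [hn]; rfl, h⟩

theorem Simulates.of_one {lcw lcw' : WConf Val Var Lock Op} {lcr lcr' : RConf Val Var Lock Op Reg}
    (hn : absSteps lcw lcr = 1) (hs : Θ.WStep lcw lcw') (h : Θ.Rwr lcw' lcr') :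
    Θ.Simulates lcw lcr lcr' :=
  ⟨lcw', by rw [hn]; exact nSteps_one hs, h⟩

/-- For contexts that leave the command unchanged: the instruction and hence the pace are the same.
Related configurations share modes and memory, so only the final command remains to be named. -/
theorem Simulates.map {c : Cmd Val Var Lock Op} {mds mem mds' mem'}
    {lcr lcr₁ lcr₂ : RConf Val Var Lock Op Reg} {s}
    (h : Θ.Simulates ⟨c, mds, mem⟩ lcr ⟨s, mds', mem'⟩)
    (hi : lcr₁.tps.text[lcr₁.tps.pc]? = lcr.tps.text[lcr.tps.pc]?)
    (hR : ∀ c', Θ.Rwr ⟨c', mds', mem'⟩ ⟨s, mds', mem'⟩ → Θ.Rwr ⟨c', mds', mem'⟩ lcr₂) :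
    Θ.Simulates ⟨c, mds, mem⟩ lcr₁ lcr₂ := by
  obtain ⟨⟨c', m, mm⟩, hn, h⟩ := h
  cases h.mds_eq
  cases h.mem_eq
  exact ⟨_, by rwa [absSteps_congr rfl hi], hR c' h⟩

/-- For contexts that append a continuation. The initial relation `h₀` is needed for the pace: if
`c` has already terminated, it guarantees a silent instruction. -/
theorem Simulates.map_seqRest {c : Cmd Val Var Lock Op} (d : Cmd Val Var Lock Op)
    {mds mem mds' mem'} {pc P regs} {lcr₁ lcr₂ : RConf Val Var Lock Op Reg} {s}
    (h : Θ.Simulates ⟨c, mds, mem⟩ ⟨⟨pc, P, regs⟩, mds, mem⟩ ⟨s, mds', mem'⟩)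
    (h₀ : Θ.Rwr ⟨c, mds, mem⟩ ⟨⟨pc, P, regs⟩, mds, mem⟩) (hpc : pc < P.length)
    (hi : lcr₁.tps.text[lcr₁.tps.pc]? = P[pc]?)
    (hR : ∀ c', Θ.Rwr ⟨c', mds', mem'⟩ ⟨s, mds', mem'⟩ →
      Θ.Rwr ⟨seqRest c' d, mds', mem'⟩ lcr₂) :
    Θ.Simulates ⟨seqRest c d, mds, mem⟩ lcr₁ lcr₂ := by
  obtain ⟨⟨c', m, mm⟩, hn, h⟩ := h
  cases h.mds_eq
  cases h.mem_eq
  refine ⟨_, ?_, hR c' h⟩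
  rw [absSteps_seqRest d hi fun hc => h₀.isEpilogue_of_halt hc hpc]
  exact nSteps_seqRest hn d

/-- In the rules for subprograms, the induction hypothesis gives the While steps, `compileCmd_step`
gives the guards at the new position, and the result is lifted back into the context. The rules for
single instructions are checked directly. -/
theorem Rwr.simulates {lcw : WConf Val Var Lock Op} {lcr : RConf Val Var Lock Op Reg}
    (h : Θ.Rwr lcw lcr) {lcr' : RConf Val Var Lock Op Reg} (hs : Θ.RStep lcr lcr') :
    Θ.Simulates lcw lcr lcr' := by
  induction h generalizing lcr' with
  | halt => exact absurd hs.lt_length (lt_irrefl _)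
  | skip_nop C l nl PCs l' nl' C' regs mds mem hr h hg =>
    cases h
    obtain ⟨_, _, _, _, rfl, hx⟩ := hs.exec rfl
    cases hx
    exact .of_one rfl (.skip _ _) (.halt_of_eq_length rfl)
  | assign_expr C l nl v e PCs l' nl' C' Pe r C₁ pc regs mds mem hr h he hpc hg =>
    obtain ⟨Pe', r', C₁', he', hw, rfl, -⟩ := compileCmd_assign h
    cases he.symm.trans he'
    obtain ⟨⟨regs', rfl, hg'⟩, lo, j, hj, hej⟩ := compileExpr_step he hr.2.2.1 hpc hg hs
    refine .of_zero (absSteps_of_isExprInstr hj hej) ?_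
    rcases (Nat.succ_le_of_lt hpc).lt_or_eq with hlt | heq
    · exact .assign_expr _ _ _ _ _ _ _ _ _ _ _ _ _ _ _ _ hr h he hlt hg'
    -- The expression is finished and the next instruction is the store, which belongs to another
    -- rule.
    · rw [show pc + 1 = Pe.length from heq] at hg' ⊢
      exact .assign_store _ _ _ _ _ _ _ _ _ _ _ _ _ _ _ hr h he hw hg'
  | assign_store C l nl v e PCs l' nl' C' Pe r C₁ regs mds mem hr h he hw hg =>
    obtain ⟨Pe', r', C₁', he', -, rfl, -⟩ := compileCmd_assign h
    cases he.symm.trans he'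
    obtain ⟨i, D, hi, hD, hDs⟩ := hg
    have hi' := getElem?_map_fst hi
    simp only [List.getElem?_concat_length, Option.some.injEq, Prod.mk.injEq] at hi
    obtain ⟨rfl, rfl⟩ := hi
    obtain ⟨_, _, _, _, rfl, hx⟩ := hs.exec hi'
    cases hx
    refine .of_one (absSteps_eq_one hi' id id) (.assign _ _ _ _) ?_
    rw [hD.1 _ _ (compileExpr_regrec he)]
    exact .halt_of_eq_length (by simp)
  | lock_acq C l nl k PCs l' nl' C' regs mds mem hr h hg =>
    have h' := h
    cases h'
    obtain ⟨_, _, _, _, rfl, hx⟩ := hs.exec rfl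
    cases hx with
    | lockAcq _ _ _ _ _ hk => exact .of_one rfl (.lockAcq _ _ _ hk) (.halt_of_eq_length rfl)
    | lockAcq_spin _ _ _ _ _ hk =>
      exact .of_one rfl (.lockAcq_spin _ _ _ hk) (.lock_acq _ _ _ _ _ _ _ _ _ _ _ hr h hg)
  | lock_rel C l nl k PCs l' nl' C' regs mds mem hr h hg =>
    have h' := h
    cases h'
    obtain ⟨_, _, _, _, rfl, hx⟩ := hs.exec rfl
    cases hx with
    | lockRel _ _ _ _ _ hk => exact .of_one rfl (.lockRel _ _ _ hk) (.halt_of_eq_length rfl)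
    | lockRel_spin _ _ _ _ _ hk =>
      exact .of_one rfl (.lockRel_spin _ _ _ hk) (.lock_rel _ _ _ _ _ _ _ _ _ _ _ hr h hg)
  | seq C l nl c₁ c₂ P₁ l₁ nl₁ C₁ P₂ l₂ nl₂ C₂ c₁' pc regs mds mem hr h₁ h₂ hj hpc hg h₀ hstart
      ih _ =>
    have hpc' : pc < (P₁.map Prod.fst).length := by simpa using hpc
    obtain ⟨pc', regs', mds', mem', rfl, hs₁⟩ := hs.of_append_left hj.1 hpc'
    have hr₁ : Θ.inputReqs C l nl c₁ := ⟨compileCmd_ne_halt h₁, hr.2.1, hr.2.2.1.1, hr.2.2.2⟩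
    have hok := compileCmd_step h₁ hr₁ hg hs₁
    refine (ih hs₁).map_seqRest c₂ h₀ hpc' (List.getElem?_append_left hpc') fun c' hR => ?_
    rcases hok.le_length.lt_or_eq with hlt | rfl
    · exact .seq _ _ _ _ _ _ _ _ _ _ _ _ _ _ _ _ _ _ hr h₁ h₂ hj hlt (hok.guardsAt hlt) hR hstart
    -- The first component is done. Its final record is valid here, which is what the premise on
    -- `c₂` needs in order to start it, and `join` places its code after that of `c₁`.
    · cases hR.eq_halt (by simp)
      rw [okAt_length] at hok
      rw [seqRest_halt]
      refine .join _ _ _ _ _ _ _ hj (by simp) ?_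
      rw [List.length_map, Nat.sub_self]
      exact hstart _ _ _ hok.1 hok.2
  | join c P₁ P₂ pc regs mds mem hj hle h₀ ih =>
    obtain ⟨q, rfl⟩ := Nat.exists_eq_add_of_le hle
    obtain ⟨pc', regs', mds', mem', rfl, hs₁⟩ := hs.of_append_right hj.2
    rw [Nat.add_sub_cancel_left] at ih
    refine (ih hs₁).map (by simp [List.getElem?_append_right]) fun c' hR => ?_
    refine .join _ _ _ _ _ _ _ hj (by simp) ?_
    rwa [Nat.add_sub_cancel_left]
  | if_expr C l nl e c₁ c₂ PCs l' C' Pe r C₁ P₁ l₁ nl₁ C₂ P₂ l₂ nl₂ C₃ pc regs mds mem hr h he h₁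
      h₂ hpc hg hstart₁ hstart₂ _ _ =>
    have hc := IteCode.of_compileCmd hr h he h₁ h₂
    rcases hpc.lt_or_eq with hlt | rfl
    · obtain ⟨⟨regs', rfl, hg'⟩, lo, j, hj, hej⟩ := hc.step_expr hlt hg hs
      exact .of_zero (absSteps_of_isExprInstr hj hej)
        (.if_expr _ _ _ _ _ _ _ _ _ _ _ _ _ _ _ _ _ _ _ _ _ _ _ _ hr h he h₁ h₂ hlt hg' hstart₁
          hstart₂)
    · obtain ⟨lo, hjz⟩ := hc.getElem?_jz
      have hone := fun mds mem => absSteps_eq_one (lcw := ⟨.ite e c₁ c₂, mds, mem⟩)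
        (lcr := ⟨⟨Pe.length, PCs.map Prod.fst, regs⟩, mds, mem⟩) hjz id id
      obtain ⟨hD, hDs, ⟨ht, rfl, -⟩ | ⟨ht, rfl, -⟩⟩ := hc.step_branch hg hs
      · exact .of_one (hone _ _) (.ite_true _ _ _ _ _ ht)
          (hc.rwr_fst h ((compileCmd_guardsAt_zero h₁ hD hDs).okAt _) (hstart₁ _ _ _ hD hDs))
      · exact .of_one (hone _ _) (.ite_false _ _ _ _ _ ht)
          (hc.rwr_snd h ((compileCmd_guardsAt_zero h₂ hD hDs).okAt _) (hstart₂ _ _ _ hD hDs))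
  | if_c1 C l nl e c₁ c₂ PCs l' C' Pe r C₁ P₁ l₁ nl₁ C₂ P₂ l₂ nl₂ C₃ c₁' pc regs mds mem
      hr h he h₁ h₂ hpc hg h₀ ih =>
    have hc := IteCode.of_compileCmd hr h he h₁ h₂
    have hf := hc.fragmentAt_fst
    obtain ⟨pc', regs', mds', mem', rfl, hs₁⟩ := hf.step hpc hs
    exact (ih hs₁).map (hf.getElem?_eq hpc) fun c' hR =>
      hc.rwr_fst h (compileCmd_step h₁ hc.reqs_fst ((hf.guardsAt_iff hpc).1 hg) hs₁) hR
  | if_c2 C l nl e c₁ c₂ PCs l' C' Pe r C₁ P₁ l₁ nl₁ C₂ P₂ l₂ nl₂ C₃ c₁' pc regs mds mem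
      hr h he h₁ h₂ hpc hg h₀ ih =>
    have hc := IteCode.of_compileCmd hr h he h₁ h₂
    have hf := hc.fragmentAt_snd
    obtain ⟨pc', regs', mds', mem', rfl, hs₁⟩ := hf.step hpc hs
    exact (ih hs₁).map (hf.getElem?_eq hpc) fun c' hR =>
      hc.rwr_snd h (compileCmd_step h₂ hc.reqs_snd ((hf.guardsAt_iff hpc).1 hg) hs₁) hR
  | epilogue_step P lo i pc regs mds mem hi he h _ =>
    have hn := absSteps_of_isEpilogue (lcw := ⟨.halt, mds, mem⟩)
      (lcr := ⟨⟨pc, P, regs⟩, mds, mem⟩) hi he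
    -- The premise of the rule is the required conclusion, for zero While steps.
    exact .of_zero hn (h _ _ hs (by rw [hn]; rfl))
  | while_expr C l nl e c PCs l' nl' C' Pe r C₁ Pc lc nlc C₂ cw pc regs mds mem hr h he h₁ hpc hcw
      hg hstart _ =>
    have hc := WhileCode.of_compileCmd hr h he h₁
    rcases hpc.lt_or_eq with hlt | rfl
    · obtain ⟨⟨regs', rfl, hg'⟩, lo, j, hj, hej⟩ := hc.step_expr hlt hg hs
      have hn := fun cw => absSteps_of_isExprInstr (lcw := ⟨cw, mds, mem⟩)
        (lcr := ⟨⟨pc, PCs.map Prod.fst, regs⟩, mds, mem⟩) hj hej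
      have hR : Θ.Rwr ⟨.ite e (.seq c (.while e c)) .halt, mds, mem⟩
          ⟨⟨pc + 1, PCs.map Prod.fst, regs'⟩, mds, mem⟩ :=
        .while_expr _ _ _ _ _ _ _ _ _ _ _ _ _ _ _ _ _ _ _ _ _ hr h he h₁ hlt
          (.inr ⟨pc.succ_pos, rfl⟩) hg' hstart
      -- At position `0` the command is the loop, which unfolds in one step; later expression
      -- instructions find the unfolded conditional and are silent.
      obtain ⟨rfl, rfl⟩ | ⟨-, rfl⟩ := hcw
      · exact .of_one (hn _) (.while _ _ _ _) hR
      · exact .of_zero (hn _) hR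
    · obtain ⟨h0, -⟩ | ⟨-, rfl⟩ := hcw
      · exact absurd h0 hc.expr_length_pos.ne'
      obtain ⟨lo, hjz⟩ := hc.getElem?_jz
      have hone := absSteps_eq_one (lcw := ⟨.ite e (.seq c (.while e c)) .halt, mds, mem⟩)
        (lcr := ⟨⟨Pe.length, PCs.map Prod.fst, regs⟩, mds, mem⟩) hjz id id
      obtain ⟨hD, hDs, ⟨ht, rfl, -⟩ | ⟨ht, rfl⟩⟩ := hc.step_branch hg hs
      · refine .of_one hone (.ite_true _ _ _ _ _ ht) ?_
        have := hc.rwr_body h hstart ((compileCmd_guardsAt_zero h₁ hD hDs).okAt _)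
          (hstart _ _ _ hD hDs)
        rwa [seqRest_of_ne_halt (compileCmd_ne_halt h₁)] at this
      · refine .of_one hone (.ite_false _ _ _ _ _ ht) ?_
        exact .halt_of_eq_length (by simp)
  | while_inner C l nl e c PCs l' nl' C' Pe r C₁ Pc lc nlc C₂ cI pc regs mds mem hr h he h₁ hpc hcI
      hg h₀ hstart ih _ =>
    have hc := WhileCode.of_compileCmd hr h he h₁
    have hf := hc.fragmentAt_body
    obtain ⟨pc', regs', mds', mem', rfl, hs₁⟩ := hf.step hpc hs
    rw [← seqRest_of_ne_halt hcI]
    exact (ih hs₁).map_seqRest _ h₀ (by simpa using hpc) (hf.getElem?_eq hpc) fun c' hR =>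
      hc.rwr_body h hstart (compileCmd_step h₁ hc.reqs_body ((hf.guardsAt_iff hpc).1 hg) hs₁) hR
  | while_loop C l nl e c PCs l' nl' C' Pe r C₁ Pc lc nlc C₂ pc regs mds mem hr h he h₁ hle hg h₀
      hstart ih _ =>
    have hc := WhileCode.of_compileCmd hr h he h₁
    rcases hle.lt_or_eq with hpc | rfl
    · have hf := hc.fragmentAt_body
      obtain ⟨pc', regs', mds', mem', rfl, hs₁⟩ := hf.step hpc hs
      -- The loop is read as a terminated body followed by the loop, so that the body's code can
      -- finish its silent instructions.
      rw [← seqRest_halt (.while e c)]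
      exact (ih hs₁).map_seqRest _ h₀ (by simpa using hpc) (hf.getElem?_eq hpc) fun c' hR =>
        hc.rwr_body h hstart (compileCmd_step h₁ hc.reqs_body ((hf.guardsAt_iff hpc).1 hg) hs₁) hR
    -- The silent jump back leads to position `0`, where `while_expr` relates the loop before it is
    -- unfolded.
    · obtain ⟨rfl, hg'⟩ := hc.step_jmp hg hs
      exact .of_zero (absSteps_of_isEpilogue (getElem?_map_fst hc.getElem?_jmp) trivial)
        (.while_expr _ _ _ _ _ _ _ _ _ _ _ _ _ _ _ _ _ _ _ _ _ hr h he h₁ (Nat.zero_le _)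
          (.inl ⟨rfl, rfl⟩) hg' hstart)

end Params

end

end WRCompiler

/-! ### The lemma. -/

theorem mainTheorem4 {Val Var Lock Op Reg : Type*}
    (Θ : WRCompiler.Params Val Var Lock Op Reg) :
    ∀ (lcw : WRCompiler.WConf Val Var Lock Op) (lcr : WRCompiler.RConf Val Var Lock Op Reg),
      Θ.Rwr lcw lcr →
        ∀ lcr' : WRCompiler.RConf Val Var Lock Op Reg, Θ.RStep lcr lcr' →
          ∃ lcw' : WRCompiler.WConf Val Var Lock Op,
            WRCompiler.nSteps Θ.WStep (WRCompiler.absSteps lcw lcr) lcw lcw' ∧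
              Θ.Rwr lcw' lcr' :=
  fun _ _ h _ hs => h.simulates hs
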